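/- Let $\mu(z)=(1+e^{-z})^{-1}$ with derivative $\dot\mu$, $L=M=1/4$, $d\ge1$, and for a positive definite matrix $A$ let $\|v\|_A=\sqrt{v^\top A v}$. Let $\Theta\subset\mathbb R^d$ be compact, $\theta_*\in\Theta$ a fixed unknown parameter and $S=\max_{\theta\in\Theta}\|\theta\|_2$. At each round $t\ge1$ an agent is offered a (context-dependent, possibly infinite, possibly random) arm set $\mathcal X_t$ contained in the Euclidean unit ball, plays $x_t\in\mathcal X_t$ and receives $r_{t+1}\in\{0,1\}$ with $\mathbb P(r_{t+1}=1\mid x_t,\mathcal F_t)=\mu(x_t^\top\theta_*)$, where $\mathcal F_t$ is generated by prior knowledge $\mathcal F_0$ and $(x_s,r_{s+1})_{1\le s<t}$. Let $\mathcal X$ be the set of all arms that can be offered at some round, $\kappa=\sup_{x\in\mathcal X,\theta\in\Theta}1/\dot\mu(x^\top\theta)$, let $x_*^t\in\arg\max_{x\in\mathcal X_t}\mu(x^\top\theta_*)$, and let $R_T=\sum_{t=1}^T\big(\mu(\theta_*^\top x_*^t)-\mu(\theta_*^\top x_t)\big)$. For $\lambda>0$, $\delta\in(0,1]$, $t\ge1$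 put $$g_t(\theta)=\sum_{s<t}\mu(x_s^\top\theta)x_s+\lambda\theta,\quad H_t(\theta)=\sum_{s<t}\dot\mu(x_s^\top\theta)x_sx_s^\top+\lambda I_d,\quad V_t=\sum_{s<t}x_sx_s^\top+\kappa\lambda I_d,$$ $$\gamma_t(\delta)=\sqrt\lambda\,(S+\tfrac12)+\frac{2}{\sqrt\lambda}\log\Big(\frac{2^d}{\delta}\Big(1+\frac{Lt}{d\lambda}\Big)^{d/2}\Big),$$ let $\hat\theta_t$ be the maximizer over $\mathbb R^d$ of $\sum_{s<t}\big[r_{s+1}\log\mu(x_s^\top\theta)+(1-r_{s+1})\log(1-\mu(x_s^\top\theta))\big]-\frac\lambda2\|\theta\|_2^2$, and let $$\mathcal C_t(\delta)=\{\theta\in\Theta:\|g_t(\theta)-g_t(\hat\theta_t)\|_{H_t^{-1}(\theta)}\le\gamma_t(\delta)\},\qquad \ell_t=\max_{\theta'\in\mathcal C_t(\delta)}|x_t^\top\theta'|$$ (with $\ell_t=0$ if $\mathcal C_t(\delta)=\emptyset$), $\mathcal W_t=\{\theta\in\Theta:|\theta^\top x_s|\le\ell_s\ \forall s\le t-1\}$.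 The algorithm computes $\theta^{(2)}_t\in\arg\min_{\theta\in\mathcal W_t}\|g_t(\theta)-g_t(\hat\theta_t)\|_{H_t^{-1}(\theta)}$ (arbitrary at a round where $\mathcal W_t=\emptyset$) and plays $x_t\in\arg\max_{x\in\mathcal X_t}\mu(x^\top\theta^{(2)}_t)+\epsilon_{t,2}(x,\theta^{(2)}_t)$, where $$\epsilon_{t,2}(x,\theta)=(2+4S)\dot\mu(x^\top\theta)\|x\|_{H_t^{-1}(\theta)}\gamma_t(\delta)+(4+8S)M\kappa\gamma_t(\delta)^2\|x\|_{V_t^{-1}}^2.$$ (i) For all $\lambda>0$, $\delta\in(0,1]$ and $T\ge1$, with probability at least $1-\delta$, $$R_T\le C_2\,\gamma_T(\delta)\sqrt T+C_3\,\gamma_T(\delta)^2\,\kappa,$$ where $$C_2=(4+8S)\sqrt{2dL\max(1,L/\lambda)\log\Big(1+\frac{LT}{d\lambda}\Big)},$$ $$C_3=Md\max\Big(1,\frac1{\kappa\lambda}\Big)\log\Big(1+\frac{T}{\kappa d\lambda}\Big)(8+16S)\big(2+2\sqrt{1+2S}\big).$$ (ii) There is a constant $C(S,\delta)$, depending only on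 $S$ and $\delta$, such that for all $T\ge2$, if the algorithm is run with $\lambda=d\log T$, then with probability at least $1-\delta$, $$R_T\le C(S,\delta)\big(d\sqrt T\log T+\kappa\,d^2(\log T)^2\big).$$ -/

import Mathlib

open MeasureTheory

noncomputable section

namespace LogisticBandit

/-- The Euclidean space of arms and parameters. -/
abbrev Vec (d : ℕ) : Type := EuclideanSpace ℝ (Fin d)

/-- The sigmoid function `μ(z) = (1 + exp (-z))⁻¹`. -/
def mu (z : ℝ) : ℝ := Real.sigmoid z

/-- The first derivative of the sigmoid. -/
def muDot (z : ℝ) : ℝ := deriv mu z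

/-- The upper bound `L = 1/4` on the first derivative of the sigmoid. -/
def L : ℝ := 1 / 4

/-- The upper bound `M = 1/4` on the second derivative of the sigmoid. -/
def M : ℝ := 1 / 4

/-- The weighted norm `‖v‖_A = √(vᵀ A v)`. -/
def wnorm {d : ℕ} (A : Matrix (Fin d) (Fin d) ℝ) (v : Vec d) : ℝ :=
  Real.sqrt (v.ofLp ⬝ᵥ A.mulVec v.ofLp)

section Path

/-! Quantities attached to one trajectory: `x s` is the arm played at round `s ≥ 1` and
`r (s + 1)` the reward it yields. Sums over `s = 1, …, t - 1` are sums over `Finset.Ico 1 t`. -/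

variable {d : ℕ}

/-- The regularized log-likelihood at round `t`. -/
def logLik (lam : ℝ) (x : ℕ → Vec d) (r : ℕ → ℝ) (t : ℕ) (θ : Vec d) : ℝ :=
  (∑ s ∈ Finset.Ico 1 t, (r (s + 1) * Real.log (mu (inner ℝ (x s) θ))
    + (1 - r (s + 1)) * Real.log (1 - mu (inner ℝ (x s) θ)))) - lam / 2 * ‖θ‖ ^ 2

/-- `g_t(θ) = ∑_{s<t} μ(x_sᵀθ) x_s + λ θ`. -/
def g (lam : ℝ) (x : ℕ → Vec d) (t : ℕ) (θ : Vec d) : Vec d :=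
  (∑ s ∈ Finset.Ico 1 t, mu (inner ℝ (x s) θ) • x s) + lam • θ

/-- `H_t(θ) = ∑_{s<t} μ'(x_sᵀθ) x_s x_sᵀ + λ I`. -/
def H (lam : ℝ) (x : ℕ → Vec d) (t : ℕ) (θ : Vec d) : Matrix (Fin d) (Fin d) ℝ :=
  (∑ s ∈ Finset.Ico 1 t,
    muDot (inner ℝ (x s) θ) • Matrix.vecMulVec (x s).ofLp (x s).ofLp) + lam • 1

/-- The design matrix `V_t = ∑_{s<t} x_s x_sᵀ + κ λ I`. -/
def V (lam κ : ℝ) (x : ℕ → Vec d) (t : ℕ) : Matrix (Fin d) (Fin d) ℝ :=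
  (∑ s ∈ Finset.Ico 1 t, Matrix.vecMulVec (x s).ofLp (x s).ofLp) + (κ * lam) • 1

/-- The confidence radius `γ_t(δ)`, in dimension `d`. -/
def gam (d : ℕ) (lam S δ : ℝ) (t : ℕ) : ℝ :=
  Real.sqrt lam * (S + 1 / 2)
    + 2 / Real.sqrt lam
      * Real.log (2 ^ d / δ * (1 + L * t / (d * lam)) ^ ((d : ℝ) / 2))

/-- The criterion `‖g_t(θ) - g_t(θhat)‖` in the norm weighted by `H_t(θ)⁻¹`. -/
def crit (lam : ℝ) (x : ℕ → Vec d) (t : ℕ) (θhat θ : Vec d) : ℝ :=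
  wnorm (H lam x t θ)⁻¹ (g lam x t θ - g lam x t θhat)

/-- The confidence set `C_t(δ)`, where `θhat t` is the maximum likelihood estimator
of round `t`. -/
def confSet (Θ : Set (Vec d)) (lam S δ : ℝ) (x : ℕ → Vec d) (θhat : ℕ → Vec d) (t : ℕ) :
    Set (Vec d) :=
  {θ | θ ∈ Θ ∧ crit lam x t (θhat t) θ ≤ gam d lam S δ t}

/-- The best-case log-odds `ℓ_s = max {|x_sᵀθ'| : θ' ∈ C_s(δ)}`
(equal to `0` if `C_s(δ)` is empty). -/
def logOdds (Θ : Set (Vec d)) (lam S δ : ℝ) (x : ℕ → Vec d) (θhat : ℕ → Vec d) (s : ℕ) : ℝ :=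
  sSup ((fun θ' : Vec d => |inner ℝ (x s) θ'|) '' confSet Θ lam S δ x θhat s)

/-- The set `W_t` of parameters with admissible log-odds. -/
def admissible (Θ : Set (Vec d)) (lam S δ : ℝ) (x : ℕ → Vec d) (θhat : ℕ → Vec d) (t : ℕ) :
    Set (Vec d) :=
  {θ | θ ∈ Θ ∧ ∀ s ∈ Finset.Ico 1 t, |inner ℝ (x s) θ| ≤ logOdds Θ lam S δ x θhat s}

/-- The exploration bonus `ε_{t,2}(z, θ)`. -/
def bonus (lam κ S δ : ℝ) (x : ℕ → Vec d) (t : ℕ) (z θ : Vec d) : ℝ :=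
  (2 + 4 * S) * muDot (inner ℝ z θ) * wnorm (H lam x t θ)⁻¹ z * gam d lam S δ t
    + (4 + 8 * S) * M * κ * gam d lam S δ t ^ 2 * wnorm (V lam κ x t)⁻¹ z ^ 2

end Path

/-- The information `F_t` available at round `t`: the prior knowledge `F0` together with
`x 1, r 2, …, x (t - 1), r t`. -/
abbrev past {d : ℕ} {Ω : Type*} (F0 : MeasurableSpace Ω) (x : ℕ → Ω → Vec d) (r : ℕ → Ω → ℝ)
    (t : ℕ) : MeasurableSpace Ω :=
  F0 ⊔ ⨆ s ∈ Finset.Ico 1 t,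
    (MeasurableSpace.comap (x s) inferInstance
      ⊔ MeasurableSpace.comap (r (s + 1)) inferInstance)

/-- A logistic contextual bandit together with the trajectory of an agent, on the probability
space `(Ω, P)`. Rounds are `t = 1, 2, …`; entries with index `0` (and `r 1`) play no role. -/
structure Bandit (d : ℕ) (Ω : Type*) [mΩ : MeasurableSpace Ω] (P : Measure Ω) where
  /-- the parameter set -/
  Θ : Set (Vec d)
  isCompact_Θ : IsCompact Θ
  /-- the unknown parameter -/
  θstar : Vec d
  θstar_mem : θstar ∈ Θ
  /-- the arm set offered at round `t`, which may depend on a random context -/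
  arms : ℕ → Ω → Set (Vec d)
  arms_norm_le : ∀ t ≥ 1, ∀ ω, ∀ z ∈ arms t ω, ‖z‖ ≤ 1
  /-- the arm played at round `t` -/
  x : ℕ → Ω → Vec d
  x_measurable : ∀ t, Measurable[mΩ] (x t)
  x_mem : ∀ t ≥ 1, ∀ ω, x t ω ∈ arms t ω
  /-- the reward `r (t + 1)` is received after playing `x t` -/
  r : ℕ → Ω → ℝ
  r_measurable : ∀ t, Measurable[mΩ] (r t)
  r_binary : ∀ t ≥ 1, ∀ ω, r (t + 1) ω = 0 ∨ r (t + 1) ω = 1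
  /-- the prior knowledge of the agent -/
  F0 : MeasurableSpace Ω
  F0_le : F0 ≤ mΩ
  /-- Given the past and the arm `x t`, the reward `r (t + 1)` is Bernoulli with parameter
  `μ(x_tᵀθ*)`. -/
  reward_law : ∀ t ≥ 1,
    P[Set.indicator {ω | r (t + 1) ω = 1} (fun _ => (1 : ℝ)) |
      past F0 x r t ⊔ MeasurableSpace.comap (x t) inferInstance]
      =ᵐ[P] fun ω => mu (inner ℝ (x t ω) θstar)
  /-- an optimal arm of round `t` -/
  xstar : ℕ → Ω → Vec d
  xstar_mem : ∀ t ≥ 1, ∀ ω, xstar t ω ∈ arms t ω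
  xstar_isMax : ∀ t ≥ 1, ∀ ω,
    IsMaxOn (fun z => mu (inner ℝ z θstar)) (arms t ω) (xstar t ω)

namespace Bandit

variable {d : ℕ} {Ω : Type*} [MeasurableSpace Ω] {P : Measure Ω}

/-- `S = max {‖θ‖ : θ ∈ Θ}`. -/
def S (b : Bandit d Ω P) : ℝ := sSup ((fun θ : Vec d => ‖θ‖) '' b.Θ)

/-- `κ = sup {1 / μ'(zᵀθ)}` over all parameters `θ ∈ Θ` and all arms `z` that can be offered
at some round. -/
def kappa (b : Bandit d Ω P) : ℝ :=
  sSup {y | ∃ t ≥ 1, ∃ ω, ∃ z ∈ b.arms t ω, ∃ θ ∈ b.Θ, y = 1 / muDot (inner ℝ z θ)}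

/-- The cumulative pseudo-regret `R_T`. -/
def regret (b : Bandit d Ω P) (T : ℕ) (ω : Ω) : ℝ :=
  ∑ t ∈ Finset.Icc 1 T,
    (mu (inner ℝ b.θstar (b.xstar t ω)) - mu (inner ℝ b.θstar (b.x t ω)))

/-- The arms of `b` are played by the second algorithm with regularization `lam` and confidence
level `δ`: `θhat` is the maximum likelihood estimator, `θ2` its projection onto the admissible
set `W_t` (no requirement at a round where `W_t` is empty), and the arm played is a maximizer of
`μ(zᵀ θ2) + ε_{t,2}(z, θ2)`. -/
structure IsSecondAlgorithm (b : Bandit d Ω P) (lam δ : ℝ) (θhat θ2 : ℕ → Ω → Vec d) :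
    Prop where
  isMax_θhat : ∀ t ≥ 1, ∀ ω,
    IsMaxOn (logLik lam (fun s => b.x s ω) (fun s => b.r s ω) t) Set.univ (θhat t ω)
  isMin_θ2 : ∀ t ≥ 1, ∀ ω,
    (admissible b.Θ lam b.S δ (fun s => b.x s ω) (fun s => θhat s ω) t).Nonempty →
      θ2 t ω ∈ admissible b.Θ lam b.S δ (fun s => b.x s ω) (fun s => θhat s ω) t ∧
      IsMinOn (crit lam (fun s => b.x s ω) t (θhat t ω))
        (admissible b.Θ lam b.S δ (fun s => b.x s ω) (fun s => θhat s ω) t) (θ2 t ω)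
  isMax_x : ∀ t ≥ 1, ∀ ω,
    IsMaxOn (fun z => mu (inner ℝ z (θ2 t ω))
        + bonus lam b.kappa b.S δ (fun s => b.x s ω) t z (θ2 t ω))
      (b.arms t ω) (b.x t ω)

end Bandit

/-- The constant `C₂`. -/
def C2 (d : ℕ) (lam S : ℝ) (T : ℕ) : ℝ :=
  (4 + 8 * S) * Real.sqrt (2 * d * L * max 1 (L / lam) * Real.log (1 + L * T / (d * lam)))

/-- The constant `C₃`. -/
def C3 (d : ℕ) (lam κ S : ℝ) (T : ℕ) : ℝ :=
  M * d * max 1 (1 / (κ * lam)) * Real.log (1 + T / (κ * d * lam))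
    * (8 + 16 * S) * (2 + 2 * Real.sqrt (1 + 2 * S))

end LogisticBandit

end

/-!
# Regret of the second optimistic algorithm for logistic bandits

The proof splits into a concentration inequality, which produces the event on which the bound
holds, and a deterministic analysis of the trajectory on that event.

*Concentration.* Write `θ*` for the true parameter. The first-order condition for the maximum
likelihood estimator gives `g_t(θ*) - g_t(θhat_t) = λ θ* - S_t`, where `S_t` is the sum of the
centred rewards weighted by the arms. For `ξ` in the unit ball, the variance bound
`E exp (a ε) ≤ exp (σ² a²)` for centred Bernoulli variables and `|a| ≤ 1` makes
`exp (ξᵀ S_t - ξᵀ (H_t(θ*) - λ I) ξ)` a supermartingale. Mixing over `ξ` with a Gaussian prior of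
precision `2 λ` truncated to the unit ball gives one nonnegative supermartingale, and Ville's
inequality (`ville`) keeps it below `1 / δ` times its initial value in all rounds. A Laplace-type
lower bound for the mixture (`exp_mul_lintegral_gaussKer_le`) and a linear change of variables
(`ofReal_mul_lintegral_gaussKer_le`) turn this into a bound for `S_t` in the norm of
`H_t(θ*)⁻¹`, so that `θ*` belongs to all the sets `C_t(δ)` (`Bandit.exists_confidence_event`).

*Regret.* On this event `θ*` is admissible, hence the projected parameter `θ2_t` lies in `C_t(δ)`
as well. For two parameters of `C_t(δ)` the form `⟨g_t(θ) - g_t(θ'), θ - θ'⟩` is at most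
`4 (1 + 2 S) γ_t²` (`inner_g_sub_le`). Self-concordance of the sigmoid compares this form with
`H_t(θ)`, up to the factor `1 + 2 S`, and since `μ'` decreases away from the origin the form also
dominates that of `V_t`, up to the factor `κ`. A Taylor expansion of `μ` then shows that the bonus
dominates the prediction error, and optimism bounds the regret of a round by twice the bonus.
Admissibility of `θ2_t` gives `H_t(θ2_t) ≥ ∑_{s<t} μ'(ℓ_s) x_s x_sᵀ + λ I`, and `μ'(x_tᵀ θ2_t)`
exceeds `μ'(ℓ_t)` only by a multiple of the `V_t⁻¹`-norm of `x_t`, so the sum of the bonuses is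
controlled by two applications of the elliptical potential lemma (`sum_wnorm_inv_sq_le`). Thus `κ`
multiplies only the term that does not grow like `√T`.

The second part of the theorem inserts `λ = d log T` into the explicit bound.
-/

noncomputable section

namespace LogisticBandit

/-! ### The sigmoid function -/

lemma muDot_eq (z : ℝ) : muDot z = mu z * (1 - mu z) := by
  have h : mu = Real.sigmoid := rfl
  rw [muDot, h, Real.deriv_sigmoid]

lemma mu_pos (z : ℝ) : 0 < mu z := Real.sigmoid_pos z

lemma mu_lt_one (z : ℝ) : mu z < 1 := Real.sigmoid_lt_one z

lemma mu_neg (z : ℝ) : mu (-z) = 1 - mu z := Real.sigmoid_neg z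

lemma hasDerivAt_mu (z : ℝ) : HasDerivAt mu (muDot z) z := by
  rw [muDot_eq]; exact Real.hasDerivAt_sigmoid z

lemma continuous_mu : Continuous mu := continuous_sigmoid

lemma continuous_muDot : Continuous muDot := by
  have h : muDot = fun z => mu z * (1 - mu z) := funext muDot_eq
  rw [h]
  exact continuous_mu.mul (continuous_const.sub continuous_mu)

lemma muDot_pos (z : ℝ) : 0 < muDot z := by
  rw [muDot_eq]; exact mul_pos (mu_pos z) (sub_pos.2 (mu_lt_one z))

lemma muDot_le (z : ℝ) : muDot z ≤ L := by
  rw [muDot_eq, L]; nlinarith [sq_nonneg (mu z - 1 / 2)]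

lemma muDot_neg (z : ℝ) : muDot (-z) = muDot z := by
  rw [muDot_eq, muDot_eq, mu_neg]; ring

lemma muDot_abs (z : ℝ) : muDot |z| = muDot z := by
  rcases abs_choice z with h | h <;> rw [h]
  exact muDot_neg z

lemma mu_mono {a b : ℝ} (h : a ≤ b) : mu a ≤ mu b := Real.sigmoid_le h

lemma muDot_antitone_abs {a b : ℝ} (h : |a| ≤ |b|) : muDot b ≤ muDot a := by
  rw [← muDot_abs a, ← muDot_abs b, muDot_eq, muDot_eq]
  have h0 : mu 0 = 1 / 2 := by simp [mu, Real.sigmoid_zero]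
  have h1 := mu_mono (abs_nonneg a)
  have h2 := mu_mono h
  nlinarith

lemma hasDerivAt_muDot (z : ℝ) : HasDerivAt muDot (muDot z * (1 - 2 * mu z)) z := by
  have h : muDot = mu * fun z => 1 - mu z := funext muDot_eq
  have h' := (hasDerivAt_mu z).mul ((hasDerivAt_mu z).const_sub 1)
  rw [← h] at h'
  exact h'.congr_deriv (by ring)

/-- `μ'` is Lipschitz with constant `M`, because `|μ''| ≤ M`. -/
lemma abs_muDot_sub_le (a b : ℝ) : |muDot b - muDot a| ≤ M * |b - a| := by
  have key : ∀ z ∈ (Set.univ : Set ℝ), ‖muDot z * (1 - 2 * mu z)‖ ≤ M := by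
    intro z _
    rw [Real.norm_eq_abs, abs_mul, abs_of_pos (muDot_pos z)]
    have h1 : |1 - 2 * mu z| ≤ 1 := abs_le.2 ⟨by linarith [mu_lt_one z], by linarith [mu_pos z]⟩
    calc muDot z * |1 - 2 * mu z| ≤ L * 1 :=
          mul_le_mul (muDot_le z) h1 (abs_nonneg _) (by norm_num [L])
      _ = M := by norm_num [L, M]
  have := convex_univ.norm_image_sub_le_of_norm_hasDerivWithin_le
    (fun z _ => (hasDerivAt_muDot z).hasDerivWithinAt) key (Set.mem_univ a) (Set.mem_univ b)
  simpa [Real.norm_eq_abs] using this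

lemma exists_mu_sub_eq (a b : ℝ) : ∃ c ∈ Set.uIcc a b, mu b - mu a = muDot c * (b - a) := by
  rcases lt_trichotomy a b with h | h | h
  · obtain ⟨c, hc, h'⟩ := exists_hasDerivAt_eq_slope mu muDot h
      continuous_mu.continuousOn (fun x _ => hasDerivAt_mu x)
    refine ⟨c, Set.Icc_subset_uIcc (Set.Ioo_subset_Icc_self hc), ?_⟩
    rw [h', div_mul_cancel₀ _ (sub_pos.2 h).ne']
  · exact ⟨a, Set.left_mem_uIcc, by simp [h]⟩
  · obtain ⟨c, hc, h'⟩ := exists_hasDerivAt_eq_slope mu muDot h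
      continuous_mu.continuousOn (fun x _ => hasDerivAt_mu x)
    refine ⟨c, Set.Icc_subset_uIcc' (Set.Ioo_subset_Icc_self hc), ?_⟩
    have := (sub_pos.2 h).ne'
    rw [h']; field_simp; ring

/-- First-order expansion of `μ` with a quadratic remainder. -/
lemma abs_mu_sub_le (a b : ℝ) : |mu b - mu a| ≤ muDot a * |b - a| + M * |b - a| ^ 2 := by
  obtain ⟨c, hc, h⟩ := exists_mu_sub_eq a b
  have h1 := (le_abs_self _).trans (abs_muDot_sub_le a c)
  have h2 : |c - a| ≤ |b - a| := Set.abs_sub_left_of_mem_uIcc hc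
  have hM : (0 : ℝ) ≤ M := by norm_num [M]
  rw [h, abs_mul, abs_of_pos (muDot_pos c)]
  have h3 : muDot c ≤ muDot a + M * |b - a| := by
    linarith [mul_le_mul_of_nonneg_left h2 hM]
  calc muDot c * |b - a| ≤ (muDot a + M * |b - a|) * |b - a| :=
        mul_le_mul_of_nonneg_right h3 (abs_nonneg _)
    _ = _ := by ring

/-- The secant slopes of `μ` are bounded below by the smaller of the slopes at the two ends,
because `μ'` is even and decreasing away from the origin. -/
lemma min_muDot_mul_sq_le (a b : ℝ) :
    min (muDot a) (muDot b) * (b - a) ^ 2 ≤ (mu b - mu a) * (b - a) := by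
  obtain ⟨c, hc, h⟩ := exists_mu_sub_eq a b
  have h1 : min (muDot a) (muDot b) ≤ muDot c := by
    have : |c| ≤ max |a| |b| := by
      rcases Set.mem_uIcc.1 hc with h | h
      · exact abs_le_max_abs_abs h.1 h.2
      · rw [max_comm]; exact abs_le_max_abs_abs h.1 h.2
    rcases le_max_iff.1 this with h | h
    · exact (min_le_left _ _).trans (muDot_antitone_abs h)
    · exact (min_le_right _ _).trans (muDot_antitone_abs h)
  rw [h]
  nlinarith [mul_le_mul_of_nonneg_right h1 (sq_nonneg (b - a))]

lemma muDot_mul_le_of_nonneg (a D : ℝ) (hD : 0 ≤ D) :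
    muDot a * D ≤ (1 + D) * (mu (a + D) - mu a) := by
  have e1 : mu a = (1 + Real.exp (-a))⁻¹ := Real.sigmoid_def a
  have e2 : mu (a + D) = (1 + Real.exp (-a) * Real.exp (-D))⁻¹ := by
    rw [← Real.exp_add, ← neg_add]; exact Real.sigmoid_def _
  have hE : (1 + D) * Real.exp (-D) ≤ 1 := by
    have := Real.add_one_le_exp D
    rw [Real.exp_neg, ← div_eq_mul_inv, div_le_one (Real.exp_pos D)]; linarith
  have hu := Real.exp_pos (-a)
  have hv := Real.exp_pos (-D)
  have hv1 : Real.exp (-D) ≤ 1 := Real.exp_le_one_iff.2 (by linarith)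
  rw [muDot_eq, e2, e1]
  set u := Real.exp (-a)
  set v := Real.exp (-D)
  have huv : 0 < u * v := mul_pos hu hv
  have e3 : (1 + u)⁻¹ * (1 - (1 + u)⁻¹) * D = (u * D) / ((1 + u) * (1 + u)) := by
    field_simp; ring
  have e4 : (1 + D) * ((1 + u * v)⁻¹ - (1 + u)⁻¹)
      = ((1 + D) * (u * (1 - v))) / ((1 + u * v) * (1 + u)) := by
    field_simp; ring
  rw [e3, e4]
  have hn : u * D ≤ (1 + D) * (u * (1 - v)) := by nlinarith
  have hd : (1 + u * v) * (1 + u) ≤ (1 + u) * (1 + u) := by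
    have : u * v ≤ u := by nlinarith
    nlinarith
  exact div_le_div₀ (le_trans (by positivity) hn) hn (by positivity) hd

/-- Self-concordance of the logistic loss: a secant slope of `μ` over an interval of length `D`
is at least `μ' / (1 + D)` at either end. -/
lemma muDot_mul_sq_le (a b : ℝ) :
    muDot a * (b - a) ^ 2 ≤ (1 + |b - a|) * ((mu b - mu a) * (b - a)) := by
  rcases le_total a b with h | h
  · have h0 : 0 ≤ b - a := sub_nonneg.2 h
    have := muDot_mul_le_of_nonneg a (b - a) h0
    rw [add_sub_cancel] at this
    rw [abs_of_nonneg h0]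
    nlinarith [mul_le_mul_of_nonneg_right this h0]
  · have h0 : 0 ≤ a - b := sub_nonneg.2 h
    have := muDot_mul_le_of_nonneg (-a) (a - b) h0
    rw [show -a + (a - b) = -b by ring, muDot_neg, mu_neg, mu_neg] at this
    rw [abs_sub_comm, abs_of_nonneg h0]
    nlinarith [mul_le_mul_of_nonneg_right this h0]

/-- The moment generating function of a centred Bernoulli variable. -/
lemma bernoulli_mgf_le {p a : ℝ} (hp0 : 0 ≤ p) (hp1 : p ≤ 1) (ha : |a| ≤ 1) :
    p * Real.exp (a * (1 - p)) + (1 - p) * Real.exp (a * (0 - p))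
      ≤ Real.exp (p * (1 - p) * a ^ 2) := by
  have hq : |a * (1 - p)| ≤ 1 := by
    rw [abs_mul, abs_of_nonneg (sub_nonneg.2 hp1)]
    nlinarith [abs_nonneg a]
  have hr : |a * (0 - p)| ≤ 1 := by
    rw [abs_mul, zero_sub, abs_neg, abs_of_nonneg hp0]
    nlinarith [abs_nonneg a]
  have h1 := (le_abs_self _).trans (Real.abs_exp_sub_one_sub_id_le hq)
  have h2 := (le_abs_self _).trans (Real.abs_exp_sub_one_sub_id_le hr)
  have h3 := Real.add_one_le_exp (p * (1 - p) * a ^ 2)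
  nlinarith [mul_le_mul_of_nonneg_left h1 hp0,
    mul_le_mul_of_nonneg_left h2 (sub_nonneg.2 hp1)]

/-! ### Weighted norms and design matrices -/

section Linear

variable {d : ℕ}

lemma dotProduct_eq_inner (u v : Vec d) : u.ofLp ⬝ᵥ v.ofLp = inner ℝ u v := by
  rw [EuclideanSpace.inner_eq_star_dotProduct, star_trivial, dotProduct_comm]

lemma wnorm_nonneg (A : Matrix (Fin d) (Fin d) ℝ) (v : Vec d) : 0 ≤ wnorm A v :=
  Real.sqrt_nonneg _

lemma wnorm_sq {A : Matrix (Fin d) (Fin d) ℝ} (hA : A.PosSemidef) (v : Vec d) :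
    wnorm A v ^ 2 = v.ofLp ⬝ᵥ A.mulVec v.ofLp :=
  Real.sq_sqrt (by simpa using hA.dotProduct_mulVec_nonneg v.ofLp)

/-- The Cauchy-Schwarz inequality for the form of a positive semidefinite matrix. -/
lemma abs_dotProduct_mulVec_le {A : Matrix (Fin d) (Fin d) ℝ} (hA : A.PosSemidef) (u v : Vec d) :
    |u.ofLp ⬝ᵥ A.mulVec v.ofLp| ≤ wnorm A u * wnorm A v := by
  have hpos : ∀ x, 0 ≤ (Matrix.toLinearMap₂' ℝ A) x x := fun x => by
    rw [Matrix.toLinearMap₂'_apply']; simpa using hA.dotProduct_mulVec_nonneg x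
  have hsymm : (Matrix.toLinearMap₂' ℝ A).IsSymm := by
    refine ⟨fun x y => ?_⟩
    have hT : A.transpose = A := by simpa [Matrix.IsHermitian] using hA.1
    simp only [RingHom.id_apply, Matrix.toLinearMap₂'_apply']
    rw [Matrix.dotProduct_mulVec, ← Matrix.mulVec_transpose, hT, dotProduct_comm]
  have h := LinearMap.BilinForm.apply_sq_le_of_symm (Matrix.toLinearMap₂' ℝ A) hpos hsymm
    u.ofLp v.ofLp
  simp only [Matrix.toLinearMap₂'_apply', ← wnorm_sq hA, ← mul_pow] at h
  exact abs_le_of_sq_le_sq h (mul_nonneg (wnorm_nonneg _ _) (wnorm_nonneg _ _))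

lemma inner_le_wnorm_inv_mul {A : Matrix (Fin d) (Fin d) ℝ} (hA : A.PosDef) (u v : Vec d) :
    |inner ℝ u v| ≤ wnorm A⁻¹ u * wnorm A v := by
  have hu := (Matrix.isUnit_iff_isUnit_det _).1 hA.isUnit
  have h := abs_dotProduct_mulVec_le hA.inv.posSemidef u (WithLp.toLp 2 (A.mulVec v.ofLp))
  have e : A⁻¹.mulVec (A.mulVec v.ofLp) = v.ofLp := by
    rw [Matrix.mulVec_mulVec, Matrix.nonsing_inv_mul _ hu, Matrix.one_mulVec]
  have e2 : wnorm A⁻¹ (WithLp.toLp 2 (A.mulVec v.ofLp)) = wnorm A v := by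
    simp only [wnorm, e, dotProduct_comm]
  rwa [e2, e, dotProduct_eq_inner] at h

/-- The norm weighted by `A⁻¹` is dual to the norm weighted by `A`. -/
lemma wnorm_inv_le {A : Matrix (Fin d) (Fin d) ℝ} (hA : A.PosDef) {v : Vec d} {k : ℝ}
    (hk : 0 ≤ k) (h : ∀ u, inner ℝ v u ≤ k * wnorm A u) : wnorm A⁻¹ v ≤ k := by
  have hu := (Matrix.isUnit_iff_isUnit_det _).1 hA.isUnit
  set u : Vec d := WithLp.toLp 2 (A⁻¹.mulVec v.ofLp) with hudef
  have e : A.mulVec u.ofLp = v.ofLp := by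
    rw [hudef, Matrix.mulVec_mulVec, Matrix.mul_nonsing_inv _ hu, Matrix.one_mulVec]
  have e1 : inner ℝ v u = wnorm A⁻¹ v ^ 2 := by
    rw [wnorm_sq hA.inv.posSemidef, ← dotProduct_eq_inner]
  have e2 : wnorm A u = wnorm A⁻¹ v := by
    rw [wnorm, e, wnorm, hudef, dotProduct_comm]
  have := h u
  rw [e1, e2, sq] at this
  rcases (wnorm_nonneg A⁻¹ v).eq_or_lt with h0 | h0
  · rwa [← h0]
  · exact le_of_mul_le_mul_right this h0

lemma wnorm_inv_sub_le {A : Matrix (Fin d) (Fin d) ℝ} (hA : A.PosDef) (u v : Vec d) :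
    wnorm A⁻¹ (u - v) ≤ wnorm A⁻¹ u + wnorm A⁻¹ v := by
  refine wnorm_inv_le hA (add_nonneg (wnorm_nonneg _ _) (wnorm_nonneg _ _)) fun w => ?_
  rw [inner_sub_left, add_mul]
  have h1 := (abs_le.1 (inner_le_wnorm_inv_mul hA u w)).2
  have h2 := (abs_le.1 (inner_le_wnorm_inv_mul hA v w)).1
  linarith

lemma wnorm_inv_anti {A B : Matrix (Fin d) (Fin d) ℝ} (hA : A.PosDef) (hB : B.PosDef) {k : ℝ}
    (hk : 0 ≤ k) (h : ∀ u, wnorm B u ≤ k * wnorm A u) (v : Vec d) :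
    wnorm A⁻¹ v ≤ k * wnorm B⁻¹ v := by
  refine wnorm_inv_le hA (mul_nonneg hk (wnorm_nonneg _ _)) fun u => ?_
  have h1 := (abs_le.1 (inner_le_wnorm_inv_mul hB v u)).2
  nlinarith [mul_le_mul_of_nonneg_left (h u) (wnorm_nonneg B⁻¹ v)]

/-- The design matrix `∑_{s<t} w_s x_s x_sᵀ + c I`, of which `H_t(θ)` and `V_t` are instances. -/
def design (w : ℕ → ℝ) (c : ℝ) (x : ℕ → Vec d) (t : ℕ) : Matrix (Fin d) (Fin d) ℝ :=
  (∑ s ∈ Finset.Ico 1 t, w s • Matrix.vecMulVec (x s).ofLp (x s).ofLp) + c • 1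

lemma H_eq_design (lam : ℝ) (x : ℕ → Vec d) (t : ℕ) (θ : Vec d) :
    H lam x t θ = design (fun s => muDot (inner ℝ (x s) θ)) lam x t := rfl

lemma V_eq_design (lam κ : ℝ) (x : ℕ → Vec d) (t : ℕ) :
    V lam κ x t = design (fun _ => 1) (κ * lam) x t := by
  simp [V, design]

lemma dotProduct_design (w : ℕ → ℝ) (c : ℝ) (x : ℕ → Vec d) (t : ℕ) (v : Vec d) :
    v.ofLp ⬝ᵥ (design w c x t).mulVec v.ofLp
      = ∑ s ∈ Finset.Ico 1 t, w s * inner ℝ (x s) v ^ 2 + c * ‖v‖ ^ 2 := by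
  rw [design, Matrix.add_mulVec, dotProduct_add, Matrix.sum_mulVec, dotProduct_sum,
    Matrix.smul_mulVec, Matrix.one_mulVec, dotProduct_smul, dotProduct_eq_inner,
    real_inner_self_eq_norm_sq, smul_eq_mul]
  congr 1
  refine Finset.sum_congr rfl fun s _ => ?_
  rw [Matrix.smul_mulVec, dotProduct_smul, Matrix.vecMulVec_mulVec, smul_eq_mul]
  simp only [dotProduct_smul, dotProduct_eq_inner, op_smul_eq_smul, smul_eq_mul]
  rw [real_inner_comm v (x s)]; ring

lemma design_isHermitian (w : ℕ → ℝ) (c : ℝ) (x : ℕ → Vec d) (t : ℕ) :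
    (design w c x t).IsHermitian := by
  rw [Matrix.IsHermitian, Matrix.conjTranspose_eq_transpose_of_trivial, design,
    Matrix.transpose_add, Matrix.transpose_sum, Matrix.transpose_smul, Matrix.transpose_one]
  congr 1
  refine Finset.sum_congr rfl fun s _ => ?_
  rw [Matrix.transpose_smul, Matrix.transpose_vecMulVec]

lemma design_posDef {w : ℕ → ℝ} {c : ℝ} {x : ℕ → Vec d} {t : ℕ}
    (hw : ∀ s ∈ Finset.Ico 1 t, 0 ≤ w s) (hc : 0 < c) : (design w c x t).PosDef := by
  refine Matrix.PosDef.of_dotProduct_mulVec_pos (design_isHermitian w c x t) fun v hv => ?_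
  have h := dotProduct_design w c x t (WithLp.toLp 2 v)
  simp only [star_trivial] at h ⊢
  rw [h]
  have h1 : 0 < ‖(WithLp.toLp 2 v : Vec d)‖ := norm_pos_iff.2 (by simpa using hv)
  have h2 : 0 ≤ ∑ s ∈ Finset.Ico 1 t, w s * inner ℝ (x s) (WithLp.toLp 2 v : Vec d) ^ 2 :=
    Finset.sum_nonneg fun s hs => mul_nonneg (hw s hs) (sq_nonneg _)
  positivity

lemma wnorm_design_sq {w : ℕ → ℝ} {c : ℝ} {x : ℕ → Vec d} {t : ℕ}
    (hw : ∀ s ∈ Finset.Ico 1 t, 0 ≤ w s) (hc : 0 < c) (v : Vec d) :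
    wnorm (design w c x t) v ^ 2
      = ∑ s ∈ Finset.Ico 1 t, w s * inner ℝ (x s) v ^ 2 + c * ‖v‖ ^ 2 := by
  rw [wnorm_sq (design_posDef hw hc).posSemidef, dotProduct_design]

lemma wnorm_design_inv_le {w : ℕ → ℝ} {c : ℝ} {x : ℕ → Vec d} {t : ℕ}
    (hw : ∀ s ∈ Finset.Ico 1 t, 0 ≤ w s) (hc : 0 < c) (v : Vec d) :
    wnorm (design w c x t)⁻¹ v ≤ ‖v‖ / Real.sqrt c := by
  refine wnorm_inv_le (design_posDef hw hc) (by positivity) fun u => ?_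
  have h : Real.sqrt c * ‖u‖ ≤ wnorm (design w c x t) u := by
    refine abs_le_of_sq_le_sq' ?_ (wnorm_nonneg _ _) |>.2
    rw [wnorm_design_sq hw hc, mul_pow, Real.sq_sqrt hc.le]
    linarith [Finset.sum_nonneg fun s hs => mul_nonneg (hw s hs) (sq_nonneg (inner ℝ (x s) u))]
  have hs : 0 < Real.sqrt c := Real.sqrt_pos.2 hc
  calc inner ℝ v u ≤ ‖v‖ * ‖u‖ := real_inner_le_norm v u
    _ = ‖v‖ / Real.sqrt c * (Real.sqrt c * ‖u‖) := by field_simp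
    _ ≤ _ := mul_le_mul_of_nonneg_left h (by positivity)

lemma design_succ (w : ℕ → ℝ) (c : ℝ) (x : ℕ → Vec d) {t : ℕ} (ht : 1 ≤ t) :
    design w c x (t + 1)
      = design w c x t + w t • Matrix.vecMulVec (x t).ofLp (x t).ofLp := by
  rw [design, design, Finset.sum_Ico_succ_top ht]
  abel

lemma det_design_succ {w : ℕ → ℝ} {c : ℝ} {x : ℕ → Vec d} {t : ℕ} (ht : 1 ≤ t)
    (hw : ∀ s ∈ Finset.Ico 1 t, 0 ≤ w s) (hc : 0 < c) :
    (design w c x (t + 1)).det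
      = (design w c x t).det * (1 + w t * wnorm (design w c x t)⁻¹ (x t) ^ 2) := by
  have hP := design_posDef (x := x) hw hc
  have hu := (Matrix.isUnit_iff_isUnit_det _).1 hP.isUnit
  have e : w t • Matrix.vecMulVec (x t).ofLp (x t).ofLp
      = Matrix.replicateCol Unit (w t • (x t).ofLp) * Matrix.replicateRow Unit (x t).ofLp := by
    rw [← Matrix.vecMulVec_eq, Matrix.smul_vecMulVec]
  rw [design_succ w c x ht, e, Matrix.det_add_replicateCol_mul_replicateRow hu,
    wnorm_sq hP.inv.posSemidef, Matrix.det_unique (n := Unit), Matrix.add_apply,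
    Matrix.one_apply_eq, ← Matrix.replicateRow_vecMul, Matrix.replicateRow_mul_replicateCol_apply,
    dotProduct_smul, smul_eq_mul, ← Matrix.dotProduct_mulVec]

/-- The determinant of a positive semidefinite matrix, by the arithmetic-geometric mean
inequality for its eigenvalues. -/
lemma det_le_trace_div_pow {A : Matrix (Fin d) (Fin d) ℝ} (hA : A.PosSemidef) (hd : 1 ≤ d) :
    A.det ≤ (A.trace / d) ^ d := by
  have hd0 : (0 : ℝ) < d := by exact_mod_cast hd
  have h := Real.geom_mean_le_arith_mean Finset.univ (fun _ => (1 : ℝ)) hA.1.eigenvalues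
    (fun _ _ => zero_le_one) (by simpa using hd0) (fun i _ => hA.eigenvalues_nonneg i)
  simp only [Real.rpow_one, Finset.sum_const, Finset.card_univ, Fintype.card_fin, nsmul_eq_mul,
    mul_one, one_mul] at h
  have e1 : A.det = ∏ i, hA.1.eigenvalues i := by
    simpa using hA.1.det_eq_prod_eigenvalues
  have e2 : A.trace = ∑ i, hA.1.eigenvalues i := by
    simpa using hA.1.trace_eq_sum_eigenvalues
  rw [← e1, ← e2] at h
  have h0 : 0 ≤ A.det := hA.det_nonneg
  calc A.det = (A.det ^ (d : ℝ)⁻¹) ^ d := by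
        rw [Real.rpow_inv_natCast_pow h0 (by omega)]
    _ ≤ _ := pow_le_pow_left₀ (Real.rpow_nonneg h0 _) h d

lemma det_design_le {w : ℕ → ℝ} {c K : ℝ} {x : ℕ → Vec d} {t : ℕ} (hd : 1 ≤ d)
    (hw : ∀ s ∈ Finset.Ico 1 t, 0 ≤ w s) (hc : 0 < c)
    (hK : ∀ s ∈ Finset.Ico 1 t, w s * ‖x s‖ ^ 2 ≤ K) :
    (design w c x t).det ≤ c ^ d * (1 + K * ((t - 1 : ℕ) : ℝ) / (d * c)) ^ d := by
  have hd0 : (0 : ℝ) < d := by exact_mod_cast hd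
  have hP := (design_posDef (x := x) hw hc).posSemidef
  refine (det_le_trace_div_pow hP hd).trans ?_
  rw [← mul_pow]
  refine pow_le_pow_left₀ (div_nonneg hP.trace_nonneg hd0.le) ?_ d
  have e : (design w c x t).trace = ∑ s ∈ Finset.Ico 1 t, w s * ‖x s‖ ^ 2 + c * d := by
    rw [design, Matrix.trace_add, Matrix.trace_sum, Matrix.trace_smul, Matrix.trace_one,
      Fintype.card_fin, smul_eq_mul]
    congr 1
    refine Finset.sum_congr rfl fun s _ => ?_
    rw [Matrix.trace_smul, Matrix.trace_vecMulVec, dotProduct_eq_inner,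
      real_inner_self_eq_norm_sq, smul_eq_mul]
  have hs := Finset.sum_le_card_nsmul _ _ _ hK
  rw [Nat.card_Ico, nsmul_eq_mul] at hs
  rw [e, div_le_iff₀ hd0]
  have : c * (1 + K * ((t - 1 : ℕ) : ℝ) / (d * c)) * d = c * d + K * ((t - 1 : ℕ) : ℝ) := by
    field_simp
  rw [this]; linarith

lemma le_two_max_mul_log {y B : ℝ} (hy : 0 ≤ y) (hB : y ≤ B) :
    y ≤ 2 * max 1 B * Real.log (1 + y) := by
  have hlog : 0 ≤ Real.log (1 + y) := Real.log_nonneg (by linarith)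
  rcases le_total y 1 with h | h
  · have h1 := Real.one_sub_inv_le_log_of_pos (show 0 < 1 + y by linarith)
    have h2 : y / 2 ≤ 1 - (1 + y)⁻¹ := by
      have : 1 - (1 + y)⁻¹ = y / (1 + y) := by field_simp; ring
      rw [this]
      exact div_le_div_of_nonneg_left hy (by linarith) (by linarith)
    nlinarith [le_max_left 1 B]
  · have h1 : (1 : ℝ) / 2 ≤ Real.log (1 + y) := by
      have := Real.log_two_gt_d9
      have h2 := Real.log_le_log (by norm_num : (0 : ℝ) < 2) (by linarith : (2 : ℝ) ≤ 1 + y)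
      linarith
    have h3 := le_max_right 1 B
    have h4 := le_max_left 1 B
    nlinarith

/-- The elliptical potential lemma. -/
lemma sum_wnorm_inv_sq_le {w : ℕ → ℝ} {c K : ℝ} {x : ℕ → Vec d} (hd : 1 ≤ d) (T : ℕ)
    (hw : ∀ s ∈ Finset.Ico 1 (T + 1), 0 ≤ w s) (hc : 0 < c)
    (hK : ∀ s ∈ Finset.Ico 1 (T + 1), w s * ‖x s‖ ^ 2 ≤ K) :
    ∑ t ∈ Finset.Ico 1 (T + 1), w t * wnorm (design w c x t)⁻¹ (x t) ^ 2
      ≤ 2 * max 1 (K / c) * (d * Real.log (1 + K * T / (d * c))) := by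
  have hsub : ∀ t ∈ Finset.Ico 1 (T + 1), ∀ s ∈ Finset.Ico 1 t, s ∈ Finset.Ico 1 (T + 1) := by
    intro t ht s hs; simp only [Finset.mem_Ico] at *; omega
  have h1 : ∀ t ∈ Finset.Ico 1 (T + 1), w t * wnorm (design w c x t)⁻¹ (x t) ^ 2
      ≤ 2 * max 1 (K / c)
        * (Real.log (design w c x (t + 1)).det - Real.log (design w c x t).det) := by
    intro t ht
    have hw' := fun s hs => hw s (hsub t ht s hs)
    have hD := (design_posDef (x := x) hw' hc).det_pos
    have hy : 0 ≤ w t * wnorm (design w c x t)⁻¹ (x t) ^ 2 := mul_nonneg (hw t ht) (sq_nonneg _)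
    rw [det_design_succ (Finset.mem_Ico.1 ht).1 hw' hc, Real.log_mul hD.ne' (by positivity),
      add_sub_cancel_left]
    refine le_two_max_mul_log hy ?_
    have h2 := pow_le_pow_left₀ (wnorm_nonneg _ _) (wnorm_design_inv_le (x := x) hw' hc (x t)) 2
    rw [div_pow, Real.sq_sqrt hc.le] at h2
    calc _ ≤ w t * (‖x t‖ ^ 2 / c) := mul_le_mul_of_nonneg_left h2 (hw t ht)
      _ = (w t * ‖x t‖ ^ 2) / c := by ring
      _ ≤ K / c := div_le_div_of_nonneg_right (hK t ht) hc.le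
  refine (Finset.sum_le_sum h1).trans ?_
  rw [← Finset.mul_sum, Finset.sum_Ico_sub (fun t => Real.log (design w c x t).det) (by omega)]
  refine mul_le_mul_of_nonneg_left ?_ (by positivity)
  have hd0 : (0 : ℝ) < d := by exact_mod_cast hd
  have e1 : (design w c x 1).det = c ^ d := by simp [design]
  have hP := (design_posDef (x := x) hw hc).det_pos
  have hle := det_design_le hd hw hc hK
  rw [Nat.add_sub_cancel] at hle
  have hcd : 0 < c ^ d := pow_pos hc d
  have hlog := Real.log_le_log hP hle
  have hB : (1 + K * T / (d * c)) ^ d ≠ 0 := fun h => by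
    rw [h, mul_zero] at hle; linarith
  rw [Real.log_mul hcd.ne' hB, Real.log_pow, Real.log_pow] at hlog
  rw [e1, Real.log_pow]; linarith

end Linear

/-! ### The maximum likelihood estimator -/

section Estimator

variable {d : ℕ}

lemma hasDerivAt_logLoss (ρ : ℝ) (z : ℝ) :
    HasDerivAt (fun z => ρ * Real.log (mu z) + (1 - ρ) * Real.log (1 - mu z)) (ρ - mu z) z := by
  have h1 := mu_pos z
  have h2 := sub_pos.2 (mu_lt_one z)
  have h := (((hasDerivAt_mu z).log h1.ne').const_mul ρ).add
    ((((hasDerivAt_mu z).const_sub 1).log h2.ne').const_mul (1 - ρ))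
  refine h.congr_deriv ?_
  rw [muDot_eq]
  field_simp
  ring

/-- The first-order condition satisfied by the maximum likelihood estimator. -/
lemma g_eq_of_isMaxOn {lam : ℝ} {x : ℕ → Vec d} {r : ℕ → ℝ} {t : ℕ} {θ : Vec d}
    (h : IsMaxOn (logLik lam x r t) Set.univ θ) :
    g lam x t θ = ∑ s ∈ Finset.Ico 1 t, r (s + 1) • x s := by
  rw [eq_comm, ← sub_eq_zero, ← inner_self_eq_zero (𝕜 := ℝ)]
  set v := ∑ s ∈ Finset.Ico 1 t, r (s + 1) • x s - g lam x t θ with hv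
  have hline : ∀ s, HasDerivAt (fun τ : ℝ => inner ℝ (x s) (θ + τ • v)) (inner ℝ (x s) v) 0 := by
    intro s
    simp only [inner_add_right, inner_smul_right]
    simpa using ((hasDerivAt_id (0 : ℝ)).mul_const (inner ℝ (x s) v)).const_add
      (inner ℝ (x s) θ)
  have hterm : ∀ s ∈ Finset.Ico 1 t, HasDerivAt (fun τ : ℝ =>
      r (s + 1) * Real.log (mu (inner ℝ (x s) (θ + τ • v)))
        + (1 - r (s + 1)) * Real.log (1 - mu (inner ℝ (x s) (θ + τ • v))))
      ((r (s + 1) - mu (inner ℝ (x s) θ)) * inner ℝ (x s) v) 0 := by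
    intro s _
    have h1 := hasDerivAt_logLoss (r (s + 1)) (inner ℝ (x s) (θ + (0 : ℝ) • v))
    have h2 := HasDerivAt.comp (0 : ℝ) h1 (hline s)
    simpa [Function.comp_def] using h2
  have hnorm : HasDerivAt (fun τ : ℝ => lam / 2 * ‖θ + τ • v‖ ^ 2) (lam * inner ℝ θ v) 0 := by
    have e : (fun τ : ℝ => lam / 2 * ‖θ + τ • v‖ ^ 2)
        = fun τ : ℝ => lam / 2 * (‖θ‖ ^ 2 + 2 * (τ * inner ℝ θ v) + τ ^ 2 * ‖v‖ ^ 2) := by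
      funext τ
      rw [norm_add_sq_real, inner_smul_right, norm_smul, mul_pow, Real.norm_eq_abs, sq_abs]
    rw [e]
    have h1 : HasDerivAt (fun τ : ℝ => ‖θ‖ ^ 2 + 2 * (τ * inner ℝ θ v) + τ ^ 2 * ‖v‖ ^ 2)
        (2 * inner ℝ θ v) 0 := by
      have := (((hasDerivAt_id (0 : ℝ)).mul_const (inner ℝ θ v)).const_mul 2).const_add
        (‖θ‖ ^ 2) |>.fun_add (((hasDerivAt_id (0 : ℝ)).pow 2).mul_const (‖v‖ ^ 2))
      simpa using this
    exact (h1.const_mul (lam / 2)).congr_deriv (by ring)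
  have hall := (HasDerivAt.fun_sum hterm).sub hnorm
  have hmax : IsLocalMax (fun τ : ℝ => logLik lam x r t (θ + τ • v)) 0 := by
    refine Filter.Eventually.of_forall fun τ => ?_
    simpa using h (Set.mem_univ (θ + τ • v))
  have h0 := hmax.hasDerivAt_eq_zero hall
  have e : ∀ u, inner ℝ v u = (∑ s ∈ Finset.Ico 1 t,
      (r (s + 1) - mu (inner ℝ (x s) θ)) * inner ℝ (x s) u) - lam * inner ℝ θ u := by
    intro u
    rw [hv]
    simp only [g, inner_sub_left, inner_add_left, sum_inner, inner_smul_left, sub_mul,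
      Finset.sum_sub_distrib, RCLike.conj_to_real]
    ring
  rw [e, h0]

end Estimator

/-! ### Confidence sets -/

section Confidence

variable {d : ℕ} {lam S κ γ : ℝ} {x : ℕ → Vec d} {t : ℕ} {θ θ' θh : Vec d}

lemma H_posDef (hlam : 0 < lam) (x : ℕ → Vec d) (t : ℕ) (θ : Vec d) : (H lam x t θ).PosDef := by
  rw [H_eq_design]; exact design_posDef (fun s _ => (muDot_pos _).le) hlam

lemma wnorm_H_sq (hlam : 0 < lam) (x : ℕ → Vec d) (t : ℕ) (θ v : Vec d) :
    wnorm (H lam x t θ) v ^ 2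
      = ∑ s ∈ Finset.Ico 1 t, muDot (inner ℝ (x s) θ) * inner ℝ (x s) v ^ 2 + lam * ‖v‖ ^ 2 := by
  rw [H_eq_design]; exact wnorm_design_sq (fun s _ => (muDot_pos _).le) hlam v

lemma V_posDef (hlam : 0 < lam) (hκ : 0 < κ) (x : ℕ → Vec d) (t : ℕ) : (V lam κ x t).PosDef := by
  rw [V_eq_design]; exact design_posDef (fun _ _ => zero_le_one) (mul_pos hκ hlam)

lemma wnorm_V_sq (hlam : 0 < lam) (hκ : 0 < κ) (x : ℕ → Vec d) (t : ℕ) (v : Vec d) :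
    wnorm (V lam κ x t) v ^ 2
      = ∑ s ∈ Finset.Ico 1 t, inner ℝ (x s) v ^ 2 + κ * lam * ‖v‖ ^ 2 := by
  rw [V_eq_design, wnorm_design_sq (fun _ _ => zero_le_one) (mul_pos hκ hlam)]
  simp

/-- The secant form `⟨g_t(θ) - g_t(θ'), θ - θ'⟩`, which interpolates between the quadratic forms
of `H_t` at `θ` and at `θ'`. -/
lemma inner_g_sub (lam : ℝ) (x : ℕ → Vec d) (t : ℕ) (θ θ' : Vec d) :
    inner ℝ (g lam x t θ - g lam x t θ') (θ - θ')
      = ∑ s ∈ Finset.Ico 1 t, (mu (inner ℝ (x s) θ) - mu (inner ℝ (x s) θ'))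
          * (inner ℝ (x s) θ - inner ℝ (x s) θ') + lam * ‖θ - θ'‖ ^ 2 := by
  have e : g lam x t θ - g lam x t θ'
      = ∑ s ∈ Finset.Ico 1 t, (mu (inner ℝ (x s) θ) - mu (inner ℝ (x s) θ')) • x s
        + lam • (θ - θ') := by
    simp only [g, sub_smul, Finset.sum_sub_distrib, smul_sub]
    abel
  rw [e, inner_add_left, sum_inner, inner_smul_left, real_inner_self_eq_norm_sq]
  simp only [inner_smul_left, inner_sub_right, RCLike.conj_to_real, mul_sub]

lemma wnorm_H_sub_sq_le (hlam : 0 < lam) (hx : ∀ s ≥ 1, ‖x s‖ ≤ 1) (hθ : ‖θ‖ ≤ S)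
    (hθ' : ‖θ'‖ ≤ S) :
    wnorm (H lam x t θ) (θ - θ') ^ 2
      ≤ (1 + 2 * S) * inner ℝ (g lam x t θ - g lam x t θ') (θ - θ') := by
  have hS : 0 ≤ S := (norm_nonneg _).trans hθ
  rw [wnorm_H_sq hlam, inner_g_sub, mul_add, Finset.mul_sum]
  refine add_le_add (Finset.sum_le_sum fun s hs => ?_) ?_
  · have hs1 := hx s (Finset.mem_Ico.1 hs).1
    have hD : |inner ℝ (x s) θ' - inner ℝ (x s) θ| ≤ 2 * S := by
      rw [← inner_sub_right]
      refine (abs_real_inner_le_norm _ _).trans ?_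
      have := (norm_sub_le θ' θ).trans (add_le_add hθ' hθ)
      nlinarith [norm_nonneg (θ' - θ), norm_nonneg (x s)]
    have h1 := muDot_mul_sq_le (inner ℝ (x s) θ) (inner ℝ (x s) θ')
    have h2 : 0 ≤ (mu (inner ℝ (x s) θ') - mu (inner ℝ (x s) θ))
        * (inner ℝ (x s) θ' - inner ℝ (x s) θ) :=
      (mul_nonneg (le_min (muDot_pos _).le (muDot_pos _).le) (sq_nonneg _)).trans
        (min_muDot_mul_sq_le _ _)
    rw [inner_sub_right]
    nlinarith [mul_le_mul_of_nonneg_right hD h2]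
  · nlinarith [mul_nonneg hlam.le (sq_nonneg ‖θ - θ'‖), mul_nonneg hS
      (mul_nonneg hlam.le (sq_nonneg ‖θ - θ'‖))]

lemma wnorm_V_sub_sq_le (hlam : 0 < lam) (hκ : 0 < κ)
    (hθ : ∀ s ≥ 1, 1 ≤ κ * muDot (inner ℝ (x s) θ))
    (hθ' : ∀ s ≥ 1, 1 ≤ κ * muDot (inner ℝ (x s) θ')) :
    wnorm (V lam κ x t) (θ - θ') ^ 2
      ≤ κ * inner ℝ (g lam x t θ - g lam x t θ') (θ - θ') := by
  rw [wnorm_V_sq hlam hκ, inner_g_sub, mul_add, Finset.mul_sum, mul_assoc]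
  refine add_le_add (Finset.sum_le_sum fun s hs => ?_) le_rfl
  have hs1 := (Finset.mem_Ico.1 hs).1
  have h1 := min_muDot_mul_sq_le (inner ℝ (x s) θ') (inner ℝ (x s) θ)
  have h2 : 1 ≤ κ * min (muDot (inner ℝ (x s) θ')) (muDot (inner ℝ (x s) θ)) := by
    rcases min_choice (muDot (inner ℝ (x s) θ')) (muDot (inner ℝ (x s) θ)) with h | h <;> rw [h]
    exacts [hθ' s hs1, hθ s hs1]
  rw [inner_sub_right]
  nlinarith [mul_le_mul_of_nonneg_left h1 hκ.le, mul_le_mul_of_nonneg_right h2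
    (sq_nonneg (inner ℝ (x s) θ - inner ℝ (x s) θ'))]

/-- Two parameters of the confidence set are close in the secant form. Each half of the secant
form is controlled by the criterion at one of the two parameters, in the dual norm of `H_t` at
that parameter, and self-concordance bounds this `H_t`-norm by the secant form again. -/
lemma inner_g_sub_le (hlam : 0 < lam) (hx : ∀ s ≥ 1, ‖x s‖ ≤ 1) (hθ : ‖θ‖ ≤ S)
    (hθ' : ‖θ'‖ ≤ S) (hc : crit lam x t θh θ ≤ γ) (hc' : crit lam x t θh θ' ≤ γ) :
    inner ℝ (g lam x t θ - g lam x t θ') (θ - θ') ≤ 4 * (1 + 2 * S) * γ ^ 2 := by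
  have hS : 0 ≤ S := (norm_nonneg _).trans hθ
  have hγ : 0 ≤ γ := (wnorm_nonneg _ _).trans hc
  set Q := inner ℝ (g lam x t θ - g lam x t θ') (θ - θ') with hQ
  have h1 : wnorm (H lam x t θ) (θ - θ') ^ 2 ≤ (1 + 2 * S) * Q := wnorm_H_sub_sq_le hlam hx hθ hθ'
  have h2 : wnorm (H lam x t θ') (θ - θ') ^ 2 ≤ (1 + 2 * S) * Q := by
    have h := wnorm_H_sub_sq_le (t := t) hlam hx hθ' hθ
    rw [← neg_sub θ θ', ← neg_sub (g lam x t θ), inner_neg_neg] at h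
    have e : wnorm (H lam x t θ') (-(θ - θ')) = wnorm (H lam x t θ') (θ - θ') := by
      simp only [wnorm, WithLp.ofLp_neg, Matrix.mulVec_neg, dotProduct_neg, neg_dotProduct,
        neg_neg]
    rwa [e] at h
  have hsplit : Q ≤ γ * wnorm (H lam x t θ) (θ - θ') + γ * wnorm (H lam x t θ') (θ - θ') := by
    have e : Q = inner ℝ (g lam x t θ - g lam x t θh) (θ - θ')
        - inner ℝ (g lam x t θ' - g lam x t θh) (θ - θ') := by
      rw [hQ, ← inner_sub_left]; congr 1; abel
    have i1 := (abs_le.1 (inner_le_wnorm_inv_mul (H_posDef hlam x t θ)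
      (g lam x t θ - g lam x t θh) (θ - θ'))).2
    have i2 := (abs_le.1 (inner_le_wnorm_inv_mul (H_posDef hlam x t θ')
      (g lam x t θ' - g lam x t θh) (θ - θ'))).1
    have j1 := mul_le_mul_of_nonneg_right hc (wnorm_nonneg (H lam x t θ) (θ - θ'))
    have j2 := mul_le_mul_of_nonneg_right hc' (wnorm_nonneg (H lam x t θ') (θ - θ'))
    rw [crit] at j1 j2
    linarith
  have hQ0 : 0 ≤ Q := by nlinarith [sq_nonneg (wnorm (H lam x t θ) (θ - θ'))]
  have hb : Q ≤ 2 * γ * Real.sqrt ((1 + 2 * S) * Q) := by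
    have k1 := Real.le_sqrt_of_sq_le h1
    have k2 := Real.le_sqrt_of_sq_le h2
    nlinarith [mul_le_mul_of_nonneg_left k1 hγ, mul_le_mul_of_nonneg_left k2 hγ]
  have hb2 : Q ^ 2 ≤ (4 * (1 + 2 * S) * γ ^ 2) * Q := by
    have := pow_le_pow_left₀ hQ0 hb 2
    rw [mul_pow, Real.sq_sqrt (by positivity)] at this
    linarith
  rcases hQ0.eq_or_lt with h | h
  · rw [← h]; positivity
  · rw [sq] at hb2; exact le_of_mul_le_mul_right hb2 h

lemma wnorm_H_sub_le (hlam : 0 < lam) (hx : ∀ s ≥ 1, ‖x s‖ ≤ 1) (hθ : ‖θ‖ ≤ S)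
    (hθ' : ‖θ'‖ ≤ S) (hc : crit lam x t θh θ ≤ γ) (hc' : crit lam x t θh θ' ≤ γ) :
    wnorm (H lam x t θ) (θ - θ') ≤ (2 + 4 * S) * γ := by
  have hS : 0 ≤ S := (norm_nonneg _).trans hθ
  have hγ : 0 ≤ γ := (wnorm_nonneg _ _).trans hc
  refine (abs_le_of_sq_le_sq' ?_ (by positivity)).2
  have h1 := wnorm_H_sub_sq_le (t := t) hlam hx hθ hθ'
  have h2 := inner_g_sub_le hlam hx hθ hθ' hc hc'
  nlinarith [mul_le_mul_of_nonneg_left h2 (show 0 ≤ 1 + 2 * S by positivity)]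

lemma wnorm_V_sub_le (hlam : 0 < lam) (hκ : 0 < κ) (hx : ∀ s ≥ 1, ‖x s‖ ≤ 1) (hθ : ‖θ‖ ≤ S)
    (hθ' : ‖θ'‖ ≤ S) (hc : crit lam x t θh θ ≤ γ) (hc' : crit lam x t θh θ' ≤ γ)
    (hk : ∀ s ≥ 1, 1 ≤ κ * muDot (inner ℝ (x s) θ))
    (hk' : ∀ s ≥ 1, 1 ≤ κ * muDot (inner ℝ (x s) θ')) :
    wnorm (V lam κ x t) (θ - θ') ≤ 2 * Real.sqrt κ * Real.sqrt (1 + 2 * S) * γ := by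
  have hS : 0 ≤ S := (norm_nonneg _).trans hθ
  have hγ : 0 ≤ γ := (wnorm_nonneg _ _).trans hc
  refine (abs_le_of_sq_le_sq' ?_ (by positivity)).2
  have h1 := wnorm_V_sub_sq_le (t := t) hlam hκ hk hk'
  have h2 := inner_g_sub_le hlam hx hθ hθ' hc hc'
  rw [mul_pow, mul_pow, mul_pow, Real.sq_sqrt hκ.le, Real.sq_sqrt (by positivity)]
  nlinarith [mul_le_mul_of_nonneg_left h2 hκ.le]

lemma wnorm_H_inv_le (hlam : 0 < lam) (hκ : 0 < κ)
    (hk : ∀ s ≥ 1, 1 ≤ κ * muDot (inner ℝ (x s) θ)) (z : Vec d) :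
    wnorm (H lam x t θ)⁻¹ z ≤ Real.sqrt κ * wnorm (V lam κ x t)⁻¹ z := by
  refine wnorm_inv_anti (H_posDef hlam x t θ) (V_posDef hlam hκ x t) (Real.sqrt_nonneg _)
    (fun u => ?_) z
  refine (abs_le_of_sq_le_sq' ?_ (mul_nonneg (Real.sqrt_nonneg _) (wnorm_nonneg _ _))).2
  rw [mul_pow, Real.sq_sqrt hκ.le, wnorm_V_sq hlam hκ, wnorm_H_sq hlam, mul_add, Finset.mul_sum,
    mul_assoc]
  refine add_le_add (Finset.sum_le_sum fun s hs => ?_) le_rfl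
  nlinarith [mul_le_mul_of_nonneg_right (hk s (Finset.mem_Ico.1 hs).1)
    (sq_nonneg (inner ℝ (x s) u))]

/-- The exploration bonus dominates the prediction error between two parameters of the
confidence set. -/
lemma abs_mu_sub_le_bonus {δ : ℝ} (hlam : 0 < lam) (hκ : 0 < κ) (hx : ∀ s ≥ 1, ‖x s‖ ≤ 1)
    (hθ : ‖θ‖ ≤ S) (hθ' : ‖θ'‖ ≤ S) (hc : crit lam x t θh θ ≤ gam d lam S δ t)
    (hc' : crit lam x t θh θ' ≤ gam d lam S δ t)
    (hk : ∀ s ≥ 1, 1 ≤ κ * muDot (inner ℝ (x s) θ))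
    (hk' : ∀ s ≥ 1, 1 ≤ κ * muDot (inner ℝ (x s) θ')) (z : Vec d) :
    |mu (inner ℝ z θ) - mu (inner ℝ z θ')| ≤ bonus lam κ S δ x t z θ := by
  have hS : 0 ≤ S := (norm_nonneg _).trans hθ
  have hγ : 0 ≤ gam d lam S δ t := (wnorm_nonneg _ _).trans hc
  have h0 := abs_mu_sub_le (inner ℝ z θ) (inner ℝ z θ')
  rw [abs_sub_comm, abs_sub_comm (inner ℝ z θ'), ← inner_sub_right] at h0
  have h1 := (inner_le_wnorm_inv_mul (H_posDef hlam x t θ) z (θ - θ')).trans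
    (mul_le_mul_of_nonneg_left (wnorm_H_sub_le hlam hx hθ hθ' hc hc') (wnorm_nonneg _ _))
  have h2 := (inner_le_wnorm_inv_mul (V_posDef hlam hκ x t) z (θ - θ')).trans
    (mul_le_mul_of_nonneg_left (wnorm_V_sub_le hlam hκ hx hθ hθ' hc hc' hk hk')
      (wnorm_nonneg _ _))
  have h3 := pow_le_pow_left₀ (abs_nonneg _) h2 2
  rw [mul_pow, mul_pow, mul_pow, mul_pow, Real.sq_sqrt hκ.le,
    Real.sq_sqrt (show 0 ≤ 1 + 2 * S by positivity)] at h3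
  have hM : (0 : ℝ) ≤ M := by norm_num [M]
  have h4 := mul_le_mul_of_nonneg_left h1 (muDot_pos (inner ℝ z θ)).le
  have h5 := mul_le_mul_of_nonneg_left h3 hM
  rw [bonus]
  linarith

end Confidence

/-! ### The constants of the problem -/

section Constants

variable {d : ℕ} {Ω : Type*} [MeasurableSpace Ω] {P : Measure Ω}

lemma Bandit.norm_le_S (b : Bandit d Ω P) {θ : Vec d} (hθ : θ ∈ b.Θ) : ‖θ‖ ≤ b.S :=
  le_csSup (b.isCompact_Θ.image continuous_norm).bddAbove (Set.mem_image_of_mem _ hθ)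

lemma Bandit.S_nonneg (b : Bandit d Ω P) : 0 ≤ b.S :=
  (norm_nonneg _).trans (b.norm_le_S b.θstar_mem)

lemma Bandit.inv_muDot_le_kappa (b : Bandit d Ω P) {t : ℕ} (ht : 1 ≤ t) {ω : Ω} {z θ : Vec d}
    (hz : z ∈ b.arms t ω) (hθ : θ ∈ b.Θ) : 1 / muDot (inner ℝ z θ) ≤ b.kappa := by
  refine le_csSup ⟨1 / muDot b.S, ?_⟩ ⟨t, ht, ω, z, hz, θ, hθ, rfl⟩
  rintro y ⟨t, ht, ω, z, hz, θ, hθ, rfl⟩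
  refine one_div_le_one_div_of_le (muDot_pos _) (muDot_antitone_abs ?_)
  rw [abs_of_nonneg b.S_nonneg]
  refine (abs_real_inner_le_norm _ _).trans ?_
  nlinarith [b.arms_norm_le t ht ω z hz, b.norm_le_S hθ, norm_nonneg z, norm_nonneg θ]

lemma Bandit.one_le_kappa_mul (b : Bandit d Ω P) {t : ℕ} (ht : 1 ≤ t) {ω : Ω} {z θ : Vec d}
    (hz : z ∈ b.arms t ω) (hθ : θ ∈ b.Θ) : 1 ≤ b.kappa * muDot (inner ℝ z θ) :=
  (div_le_iff₀ (muDot_pos _)).1 (b.inv_muDot_le_kappa ht hz hθ)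

lemma Bandit.four_le_kappa (b : Bandit d Ω P) (ω : Ω) : 4 ≤ b.kappa := by
  refine le_trans ?_ (b.inv_muDot_le_kappa le_rfl (b.x_mem 1 le_rfl ω) b.θstar_mem)
  rw [le_div_iff₀ (muDot_pos _)]
  have := muDot_le (inner ℝ (b.x 1 ω) b.θstar)
  rw [L] at this
  linarith

lemma log_arg_ge_one {lam δ : ℝ} (hlam : 0 < lam) (hδ : 0 < δ) (hδ1 : δ ≤ 1) (t : ℕ) :
    1 ≤ 2 ^ d / δ * (1 + L * t / (d * lam)) ^ ((d : ℝ) / 2) := by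
  have h1 : (1 : ℝ) ≤ 2 ^ d / δ := by
    rw [le_div_iff₀ hδ]; linarith [one_le_pow₀ (M₀ := ℝ) (n := d) one_le_two]
  have h2 : (1 : ℝ) ≤ (1 + L * t / (d * lam)) ^ ((d : ℝ) / 2) := by
    refine Real.one_le_rpow ?_ (by positivity)
    have : (0 : ℝ) ≤ L * t / (d * lam) := by rw [L]; positivity
    linarith
  exact one_le_mul_of_one_le_of_one_le h1 h2

lemma gam_nonneg {lam S δ : ℝ} (hlam : 0 < lam) (hS : 0 ≤ S) (hδ : 0 < δ) (hδ1 : δ ≤ 1) (t : ℕ) :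
    0 ≤ gam d lam S δ t := by
  have := Real.log_nonneg (log_arg_ge_one (d := d) hlam hδ hδ1 t)
  rw [gam]; positivity

lemma gam_mono {lam S δ : ℝ} (hlam : 0 < lam) (hδ : 0 < δ) (hδ1 : δ ≤ 1) {t T : ℕ}
    (h : t ≤ T) : gam d lam S δ t ≤ gam d lam S δ T := by
  rw [gam, gam]
  have h0 := lt_of_lt_of_le one_pos (log_arg_ge_one (d := d) hlam hδ hδ1 t)
  have h1 : (0 : ℝ) ≤ L * t / (d * lam) := by rw [L]; positivity
  have hL : (0 : ℝ) ≤ L := by norm_num [L]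
  gcongr

end Constants

/-! ### Regret on the confidence event -/

section Regret

variable {d : ℕ} {lam S κ γ δ : ℝ} {x : ℕ → Vec d} {t : ℕ} {Θ : Set (Vec d)}

/-- `μ'` at the arm played and the admissible parameter exceeds `μ'(ℓ_t)` by at most a multiple
of `‖x_t‖` in the norm of `V_t⁻¹`: the log-odds of all parameters in the confidence set are
within that distance of each other. -/
lemma muDot_le_muDot_logOdds_add {θhat : ℕ → Vec d} {θ : Vec d} (hlam : 0 < lam) (hκ : 0 < κ)
    (hx : ∀ s ≥ 1, ‖x s‖ ≤ 1) (hS : ∀ θ ∈ Θ, ‖θ‖ ≤ S)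
    (hk : ∀ θ ∈ Θ, ∀ s ≥ 1, 1 ≤ κ * muDot (inner ℝ (x s) θ))
    (hθ : θ ∈ confSet Θ lam S δ x θhat t) :
    muDot (inner ℝ (x t) θ) ≤ muDot (logOdds Θ lam S δ x θhat t)
      + M * (2 * Real.sqrt κ * Real.sqrt (1 + 2 * S) * gam d lam S δ t
          * wnorm (V lam κ x t)⁻¹ (x t)) := by
  set B := 2 * Real.sqrt κ * Real.sqrt (1 + 2 * S) * gam d lam S δ t
    * wnorm (V lam κ x t)⁻¹ (x t) with hB
  have hclose : ∀ θ' ∈ confSet Θ lam S δ x θhat t,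
      |inner ℝ (x t) θ'| ≤ |inner ℝ (x t) θ| + B := by
    intro θ' hθ'
    have h1 := (inner_le_wnorm_inv_mul (V_posDef hlam hκ x t) (x t) (θ' - θ)).trans
      (mul_le_mul_of_nonneg_left (wnorm_V_sub_le hlam hκ hx (hS _ hθ'.1) (hS _ hθ.1) hθ'.2 hθ.2
        (hk _ hθ'.1) (hk _ hθ.1)) (wnorm_nonneg _ _))
    rw [inner_sub_right, mul_comm] at h1
    linarith [abs_sub_abs_le_abs_sub (inner ℝ (x t) θ' : ℝ) (inner ℝ (x t) θ)]
  have hle : logOdds Θ lam S δ x θhat t ≤ |inner ℝ (x t) θ| + B := by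
    refine csSup_le ⟨_, Set.mem_image_of_mem _ hθ⟩ ?_
    rintro _ ⟨θ', hθ', rfl⟩
    exact hclose θ' hθ'
  have hge : |inner ℝ (x t) θ| ≤ logOdds Θ lam S δ x θhat t := by
    refine le_csSup ⟨|inner ℝ (x t) θ| + B, ?_⟩ (Set.mem_image_of_mem _ hθ)
    rintro _ ⟨θ', hθ', rfl⟩
    exact hclose θ' hθ'
  have h2 := (le_abs_self _).trans
    (abs_muDot_sub_le (logOdds Θ lam S δ x θhat t) |inner ℝ (x t) θ|)
  have h3 : |(|inner ℝ (x t) θ| - logOdds Θ lam S δ x θhat t)| ≤ B := by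
    rw [abs_sub_comm, abs_of_nonneg (by linarith)]; linarith
  have hM : (0 : ℝ) ≤ M := by norm_num [M]
  have h4 := mul_le_mul_of_nonneg_left h3 hM
  rw [muDot_abs] at h2
  linarith

/-- The design matrix weighted by the slopes at the best-case log-odds lies below `H_t(θ)` for
every admissible `θ`. -/
lemma wnorm_H_inv_le_design {θhat : ℕ → Vec d} {θ : Vec d} (hlam : 0 < lam)
    (hθ : θ ∈ admissible Θ lam S δ x θhat t) (z : Vec d) :
    wnorm (H lam x t θ)⁻¹ z
      ≤ wnorm (design (fun s => muDot (logOdds Θ lam S δ x θhat s)) lam x t)⁻¹ z := by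
  have hw : ∀ s ∈ Finset.Ico 1 t, 0 ≤ muDot (logOdds Θ lam S δ x θhat s) :=
    fun s _ => (muDot_pos _).le
  have := wnorm_inv_anti (H_posDef hlam x t θ) (design_posDef (x := x) hw hlam) zero_le_one
    (fun u => ?_) z
  · simpa using this
  · rw [one_mul]
    refine (abs_le_of_sq_le_sq' ?_ (wnorm_nonneg _ _)).2
    rw [wnorm_H_sq hlam, wnorm_design_sq hw hlam]
    refine add_le_add (Finset.sum_le_sum fun s hs => ?_) le_rfl
    exact mul_le_mul_of_nonneg_right
      (muDot_antitone_abs ((hθ.2 s hs).trans (le_abs_self _))) (sq_nonneg _)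

/-- The bonus of the arm played, in terms of two quantities to which the elliptical potential
lemma applies. -/
lemma bonus_le {θhat : ℕ → Vec d} {θ : Vec d} (hlam : 0 < lam) (hκ : 0 < κ) (hS0 : 0 ≤ S)
    (hγ : 0 ≤ gam d lam S δ t) (hx : ∀ s ≥ 1, ‖x s‖ ≤ 1) (hS : ∀ θ ∈ Θ, ‖θ‖ ≤ S)
    (hk : ∀ θ ∈ Θ, ∀ s ≥ 1, 1 ≤ κ * muDot (inner ℝ (x s) θ))
    (hθ : θ ∈ confSet Θ lam S δ x θhat t) (hθ' : θ ∈ admissible Θ lam S δ x θhat t) :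
    2 * bonus lam κ S δ x t (x t) θ ≤
      (4 + 8 * S) * gam d lam S δ t * (muDot (logOdds Θ lam S δ x θhat t)
        * wnorm (design (fun s => muDot (logOdds Θ lam S δ x θhat s)) lam x t)⁻¹ (x t))
      + (8 + 16 * S) * M * κ * gam d lam S δ t ^ 2 * (1 + Real.sqrt (1 + 2 * S))
        * wnorm (V lam κ x t)⁻¹ (x t) ^ 2 := by
  have h1 := muDot_le_muDot_logOdds_add hlam hκ hx hS hk hθ
  have h2 := wnorm_H_inv_le_design hlam hθ' (x t)
  have h3 := wnorm_H_inv_le (t := t) hlam hκ (hk θ hθ.1) (x t)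
  have hM : (0 : ℝ) ≤ M := by norm_num [M]
  have hH := wnorm_nonneg (H lam x t θ)⁻¹ (x t)
  have hV := wnorm_nonneg (V lam κ x t)⁻¹ (x t)
  set w := wnorm (H lam x t θ)⁻¹ (x t)
  set v := wnorm (V lam κ x t)⁻¹ (x t)
  set ℓ := muDot (logOdds Θ lam S δ x θhat t) with hℓ
  set y := wnorm (design (fun s => muDot (logOdds Θ lam S δ x θhat s)) lam x t)⁻¹ (x t)
  set γ := gam d lam S δ t
  have hℓ0 : 0 ≤ ℓ := (muDot_pos _).le
  have key : muDot (inner ℝ (x t) θ) * w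
      ≤ ℓ * y + 2 * M * κ * Real.sqrt (1 + 2 * S) * γ * v ^ 2 := by
    calc muDot (inner ℝ (x t) θ) * w
        ≤ (ℓ + M * (2 * Real.sqrt κ * Real.sqrt (1 + 2 * S) * γ * v)) * w :=
          mul_le_mul_of_nonneg_right h1 hH
      _ = ℓ * w + M * (2 * Real.sqrt κ * Real.sqrt (1 + 2 * S) * γ * v) * w := by ring
      _ ≤ ℓ * y + M * (2 * Real.sqrt κ * Real.sqrt (1 + 2 * S) * γ * v) * (Real.sqrt κ * v) := by
          refine add_le_add (mul_le_mul_of_nonneg_left h2 hℓ0)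
            (mul_le_mul_of_nonneg_left h3 (by positivity))
      _ = ℓ * y + 2 * M * (Real.sqrt κ * Real.sqrt κ) * Real.sqrt (1 + 2 * S) * γ * v ^ 2 := by
          ring
      _ = _ := by rw [Real.mul_self_sqrt hκ.le]
  have := mul_le_mul_of_nonneg_left key (show 0 ≤ (4 + 8 * S) * γ by positivity)
  rw [bonus]
  nlinarith

variable {Ω : Type*} [MeasurableSpace Ω] {P : Measure Ω}

/-- Optimism: on the confidence event the regret of a round is at most twice the bonus. -/
lemma Bandit.round_regret_le (b : Bandit d Ω P) (hlam : 0 < lam) {θhat θ2 : ℕ → Ω → Vec d}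
    (alg : b.IsSecondAlgorithm lam δ θhat θ2) {ω : Ω} (ht : 1 ≤ t)
    (h : ∀ s ∈ Finset.Icc 1 t,
      crit lam (fun s => b.x s ω) s (θhat s ω) b.θstar ≤ gam d lam b.S δ s) :
    θ2 t ω ∈ confSet b.Θ lam b.S δ (fun s => b.x s ω) (fun s => θhat s ω) t ∧
    θ2 t ω ∈ admissible b.Θ lam b.S δ (fun s => b.x s ω) (fun s => θhat s ω) t ∧
    mu (inner ℝ b.θstar (b.xstar t ω)) - mu (inner ℝ b.θstar (b.x t ω))
      ≤ 2 * bonus lam b.kappa b.S δ (fun s => b.x s ω) t (b.x t ω) (θ2 t ω) := by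
  have hκ : 0 < b.kappa := lt_of_lt_of_le (by norm_num) (b.four_le_kappa ω)
  have hx : ∀ s ≥ 1, ‖b.x s ω‖ ≤ 1 := fun s hs => b.arms_norm_le s hs ω _ (b.x_mem s hs ω)
  have hk : ∀ θ ∈ b.Θ, ∀ s ≥ 1, 1 ≤ b.kappa * muDot (inner ℝ (b.x s ω) θ) :=
    fun θ hθ s hs => b.one_le_kappa_mul hs (b.x_mem s hs ω) hθ
  have hstar : ∀ s ∈ Finset.Icc 1 t,
      b.θstar ∈ confSet b.Θ lam b.S δ (fun s => b.x s ω) (fun s => θhat s ω) s :=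
    fun s hs => ⟨b.θstar_mem, h s hs⟩
  have hadm : b.θstar ∈ admissible b.Θ lam b.S δ (fun s => b.x s ω) (fun s => θhat s ω) t := by
    refine ⟨b.θstar_mem, fun s hs => ?_⟩
    have hs' := Finset.mem_Ico.1 hs
    refine le_csSup ⟨b.S, ?_⟩
      (Set.mem_image_of_mem _ (hstar s (Finset.mem_Icc.2 ⟨hs'.1, hs'.2.le⟩)))
    rintro _ ⟨θ, hθ, rfl⟩
    refine (abs_real_inner_le_norm _ _).trans ?_
    nlinarith [hx s hs'.1, b.norm_le_S hθ.1, norm_nonneg (b.x s ω), norm_nonneg θ]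
  obtain ⟨hmem, hmin⟩ := alg.isMin_θ2 t ht ω ⟨_, hadm⟩
  have hcs := hstar t (Finset.mem_Icc.2 ⟨ht, le_rfl⟩)
  have hconf : θ2 t ω ∈ confSet b.Θ lam b.S δ (fun s => b.x s ω) (fun s => θhat s ω) t :=
    ⟨hmem.1, le_trans (hmin hadm) hcs.2⟩
  refine ⟨hconf, hmem, ?_⟩
  have hpred := abs_mu_sub_le_bonus (x := fun s => b.x s ω) hlam hκ hx (b.norm_le_S hmem.1)
    (b.norm_le_S b.θstar_mem) hconf.2 hcs.2 (hk _ hmem.1) (hk _ b.θstar_mem)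
  have h1 := (abs_le.1 (hpred (b.xstar t ω))).1
  have h2 := (abs_le.1 (hpred (b.x t ω))).2
  have h3 := alg.isMax_x t ht ω (b.xstar_mem t ht ω)
  simp only [Set.mem_ofPred_eq] at h3
  rw [real_inner_comm (b.xstar t ω) b.θstar, real_inner_comm (b.x t ω) b.θstar]
  linarith

/-- The regret bound on the event that the confidence sets contain the true parameter. -/
theorem Bandit.regret_le_of_crit_le (b : Bandit d Ω P) (hd : 1 ≤ d) (hlam : 0 < lam)
    (hδ : 0 < δ) (hδ1 : δ ≤ 1) {θhat θ2 : ℕ → Ω → Vec d}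
    (alg : b.IsSecondAlgorithm lam δ θhat θ2) {ω : Ω} (T : ℕ)
    (h : ∀ s ∈ Finset.Icc 1 T,
      crit lam (fun s => b.x s ω) s (θhat s ω) b.θstar ≤ gam d lam b.S δ s) :
    b.regret T ω ≤ C2 d lam b.S T * gam d lam b.S δ T * Real.sqrt T
      + C3 d lam b.kappa b.S T * gam d lam b.S δ T ^ 2 * b.kappa := by
  have hS := b.S_nonneg
  have hκ : 0 < b.kappa := lt_of_lt_of_le (by norm_num) (b.four_le_kappa ω)
  have hx : ∀ s ≥ 1, ‖b.x s ω‖ ≤ 1 := fun s hs => b.arms_norm_le s hs ω _ (b.x_mem s hs ω)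
  have hxsq : ∀ s ≥ 1, ‖b.x s ω‖ ^ 2 ≤ 1 := fun s hs => pow_le_one₀ (norm_nonneg _) (hx s hs)
  have hk : ∀ θ ∈ b.Θ, ∀ s ≥ 1, 1 ≤ b.kappa * muDot (inner ℝ (b.x s ω) θ) :=
    fun θ hθ s hs => b.one_le_kappa_mul hs (b.x_mem s hs ω) hθ
  have hM : (0 : ℝ) ≤ M := by norm_num [M]
  have hL : (0 : ℝ) ≤ L := by norm_num [L]
  set w : ℕ → ℝ := fun s =>
    muDot (logOdds b.Θ lam b.S δ (fun s => b.x s ω) (fun s => θhat s ω) s) with hw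
  have hw0 : ∀ s, 0 ≤ w s := fun s => (muDot_pos _).le
  set X : ℕ → Vec d := fun s => b.x s ω with hX
  set γ := gam d lam b.S δ T with hγdef
  have hγ : 0 ≤ γ := gam_nonneg hlam hS hδ hδ1 T
  set y : ℕ → ℝ := fun t => wnorm (design w lam X t)⁻¹ (X t) with hy
  set v : ℕ → ℝ := fun t => wnorm (V lam b.kappa X t)⁻¹ (X t) with hv
  -- each round, with the radius of the last one
  have hround : ∀ t ∈ Finset.Ico 1 (T + 1),
      mu (inner ℝ b.θstar (b.xstar t ω)) - mu (inner ℝ b.θstar (b.x t ω))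
        ≤ (4 + 8 * b.S) * γ * (w t * y t)
          + (8 + 16 * b.S) * M * b.kappa * γ ^ 2 * (1 + Real.sqrt (1 + 2 * b.S)) * v t ^ 2 := by
    intro t ht
    have ht' := Finset.mem_Ico.1 ht
    obtain ⟨h1, h2, h3⟩ := b.round_regret_le hlam alg ht'.1 fun s hs => h s
      (Finset.mem_Icc.2 ⟨(Finset.mem_Icc.1 hs).1, by have := (Finset.mem_Icc.1 hs).2; omega⟩)
    have hγt : 0 ≤ gam d lam b.S δ t := gam_nonneg hlam hS hδ hδ1 t
    have hγle : gam d lam b.S δ t ≤ γ := gam_mono hlam hδ hδ1 (by omega)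
    refine h3.trans ((bonus_le (x := X) hlam hκ hS hγt hx (fun θ hθ => b.norm_le_S hθ) hk
      h1 h2).trans ?_)
    have hwy : 0 ≤ w t * y t := mul_nonneg (hw0 t) (wnorm_nonneg _ _)
    have hvv : 0 ≤ v t := wnorm_nonneg _ _
    change (4 + 8 * b.S) * gam d lam b.S δ t * (w t * y t) + (8 + 16 * b.S) * M * b.kappa
      * gam d lam b.S δ t ^ 2 * (1 + Real.sqrt (1 + 2 * b.S)) * v t ^ 2 ≤ _
    gcongr
  -- the two elliptical potentials
  have hpot1 := sum_wnorm_inv_sq_le (x := X) (w := w) (K := L) hd T (fun s _ => hw0 s) hlam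
    (fun s hs => by
      have h1 := muDot_le (logOdds b.Θ lam b.S δ X (fun s => θhat s ω) s)
      have h2 := hxsq s (Finset.mem_Ico.1 hs).1
      calc w s * ‖X s‖ ^ 2 ≤ L * 1 := mul_le_mul h1 h2 (sq_nonneg _) hL
        _ = L := mul_one _)
  have hpot2 := sum_wnorm_inv_sq_le (x := X) (w := fun _ => 1) (K := 1) hd T
    (fun s _ => zero_le_one) (mul_pos hκ hlam)
    (fun s hs => by simpa using hxsq s (Finset.mem_Ico.1 hs).1)
  simp only [← V_eq_design, one_mul] at hpot2
  change ∑ t ∈ Finset.Ico 1 (T + 1), w t * y t ^ 2 ≤ _ at hpot1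
  change ∑ t ∈ Finset.Ico 1 (T + 1), v t ^ 2 ≤ _ at hpot2
  -- Cauchy-Schwarz for the first potential, after extracting `w_t ≤ √L √w_t`
  have hsum1 : ∑ t ∈ Finset.Ico 1 (T + 1), w t * y t
      ≤ Real.sqrt (2 * d * L * max 1 (L / lam) * Real.log (1 + L * T / (d * lam)))
        * Real.sqrt T := by
    have hcs := Finset.sum_mul_sq_le_sq_mul_sq (Finset.Ico 1 (T + 1)) (fun _ => (1 : ℝ))
      (fun t => w t * y t)
    simp only [one_mul, one_pow, Finset.sum_const, Nat.card_Ico, Nat.add_sub_cancel,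
      nsmul_eq_mul, mul_one] at hcs
    have h1 : ∑ t ∈ Finset.Ico 1 (T + 1), (w t * y t) ^ 2
        ≤ L * (2 * max 1 (L / lam) * (d * Real.log (1 + L * T / (d * lam)))) := by
      refine le_trans ?_ (mul_le_mul_of_nonneg_left hpot1 hL)
      rw [Finset.mul_sum]
      refine Finset.sum_le_sum fun t _ => ?_
      have : w t * (w t * y t ^ 2) ≤ L * (w t * y t ^ 2) :=
        mul_le_mul_of_nonneg_right (muDot_le _) (mul_nonneg (hw0 t) (sq_nonneg _))
      linarith
    rw [← Real.sqrt_mul' _ (Nat.cast_nonneg T)]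
    refine Real.le_sqrt_of_sq_le (hcs.trans ?_)
    have := mul_le_mul_of_nonneg_left h1 (Nat.cast_nonneg (α := ℝ) T)
    linarith
  have e : Finset.Icc 1 T = Finset.Ico 1 (T + 1) := by ext; simp
  rw [Bandit.regret, e]
  refine (Finset.sum_le_sum hround).trans ?_
  rw [Finset.sum_add_distrib, ← Finset.mul_sum, ← Finset.mul_sum]
  refine add_le_add ?_ ?_
  · have := mul_le_mul_of_nonneg_left hsum1 (show 0 ≤ (4 + 8 * b.S) * γ by positivity)
    rw [C2]; linarith
  · have h1 := mul_le_mul_of_nonneg_left hpot2 (show 0 ≤ (8 + 16 * b.S) * M * b.kappa * γ ^ 2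
      * (1 + Real.sqrt (1 + 2 * b.S)) by positivity)
    have e2 : (d : ℝ) * (b.kappa * lam) = b.kappa * d * lam := by ring
    rw [e2] at h1
    rw [C3]; linarith

end Regret

/-! ### Truncated Gaussian integrals -/

section Gaussian

open scoped ENNReal

variable {d : ℕ}

/-- The Gaussian weight `exp (-ξᵀ A ξ)` truncated to the ball `ξᵀ ξ ≤ ρ`. -/
def gaussKer (A : Matrix (Fin d) (Fin d) ℝ) (ρ : ℝ) : (Fin d → ℝ) → ℝ≥0∞ :=
  Set.indicator {ξ | ξ ⬝ᵥ ξ ≤ ρ} fun ξ => ENNReal.ofReal (Real.exp (-(ξ ⬝ᵥ A.mulVec ξ)))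

lemma continuous_quadForm (A : Matrix (Fin d) (Fin d) ℝ) :
    Continuous fun ξ : Fin d → ℝ => ξ ⬝ᵥ A.mulVec ξ :=
  continuous_id.dotProduct (continuous_const.matrix_mulVec continuous_id)

lemma measurableSet_ball (ρ : ℝ) : MeasurableSet {ξ : Fin d → ℝ | ξ ⬝ᵥ ξ ≤ ρ} :=
  (isClosed_le (continuous_id.dotProduct continuous_id) continuous_const).measurableSet

lemma measurable_gaussKer (A : Matrix (Fin d) (Fin d) ℝ) (ρ : ℝ) : Measurable (gaussKer A ρ) :=
  Measurable.indicator
    (ENNReal.measurable_ofReal.comp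
      (Real.continuous_exp.comp (continuous_quadForm A).neg).measurable)
    (measurableSet_ball ρ)

lemma lintegral_comp_mulVec {C : Matrix (Fin d) (Fin d) ℝ} (hC : C.det ≠ 0)
    {f : (Fin d → ℝ) → ℝ≥0∞} (hf : Measurable f) :
    ∫⁻ ξ, f (C.mulVec ξ) = ENNReal.ofReal |C.det⁻¹| * ∫⁻ ξ, f ξ := by
  have hm : Measurable (Matrix.toLin' C) := by
    have : Continuous fun ξ : Fin d → ℝ => C.mulVec ξ :=
      continuous_const.matrix_mulVec continuous_id
    exact this.measurable
  rw [← smul_eq_mul, ← lintegral_smul_measure, ← Real.map_matrix_volume_pi_eq_smul_volume_pi hC,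
    lintegral_map hf hm]
  rfl

lemma exists_factor {A : Matrix (Fin d) (Fin d) ℝ} (hA : A.PosSemidef) :
    ∃ C : Matrix (Fin d) (Fin d) ℝ, A = C.transpose * C := by
  open scoped MatrixOrder in
  obtain ⟨C, hC⟩ := CStarAlgebra.nonneg_iff_eq_star_mul_self.mp hA.nonneg
  exact ⟨C, hC⟩

lemma dotProduct_smul_one_mulVec (c : ℝ) (ξ : Fin d → ℝ) :
    ξ ⬝ᵥ (c • (1 : Matrix (Fin d) (Fin d) ℝ)).mulVec ξ = c * (ξ ⬝ᵥ ξ) := by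
  rw [Matrix.smul_mulVec, Matrix.one_mulVec, dotProduct_smul, smul_eq_mul]

lemma dotProduct_self_nonneg_real (ξ : Fin d → ℝ) : 0 ≤ ξ ⬝ᵥ ξ :=
  Finset.sum_nonneg fun i _ => mul_self_nonneg (ξ i)

/-- Among the Gaussian weights with `λ I ≤ A`, the mass on a ball is at least the mass for `λ I`
times the ratio of the normalizing constants: the linear change of variables that turns one
weight into the other contracts the ball. -/
lemma ofReal_mul_lintegral_gaussKer_le {A : Matrix (Fin d) (Fin d) ℝ} (hA : A.PosDef) {lam : ℝ}
    (hlam : 0 < lam) (hle : ∀ ξ : Fin d → ℝ, lam * (ξ ⬝ᵥ ξ) ≤ ξ ⬝ᵥ A.mulVec ξ) (ρ : ℝ) :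
    ENNReal.ofReal (Real.sqrt (lam ^ d / A.det))
        * ∫⁻ ξ, gaussKer (lam • 1 : Matrix (Fin d) (Fin d) ℝ) ρ ξ
      ≤ ∫⁻ ξ : Fin d → ℝ, gaussKer A ρ ξ := by
  obtain ⟨C, hC⟩ := exists_factor hA.posSemidef
  set s := Real.sqrt lam with hs
  have hs0 : 0 < s := Real.sqrt_pos.2 hlam
  have hdetA : A.det = C.det ^ 2 := by rw [hC, Matrix.det_mul, Matrix.det_transpose, sq]
  have hC0 : C.det ≠ 0 := by
    intro h
    have := hA.det_pos
    rw [hdetA, h] at this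
    simp at this
  set B := s⁻¹ • C with hB
  have hdetB : B.det = s⁻¹ ^ d * C.det := by rw [hB, Matrix.det_smul, Fintype.card_fin]
  have hB0 : B.det ≠ 0 := by rw [hdetB]; positivity
  have hquad : ∀ ξ : Fin d → ℝ, lam * (B.mulVec ξ ⬝ᵥ B.mulVec ξ) = ξ ⬝ᵥ A.mulVec ξ := by
    intro ξ
    rw [hB, Matrix.smul_mulVec, dotProduct_smul, smul_dotProduct, hC, ← Matrix.mulVec_mulVec,
      Matrix.dotProduct_mulVec ξ, Matrix.vecMul_transpose, smul_eq_mul, smul_eq_mul,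
      ← Real.sq_sqrt hlam.le, ← hs]
    field_simp
  have hconst : |B.det⁻¹| = Real.sqrt (lam ^ d / A.det) := by
    rw [hdetA, Real.sqrt_div (by positivity), Real.sqrt_sq_eq_abs, hdetB, mul_inv, abs_mul,
      inv_pow, inv_inv, abs_inv, ← div_eq_mul_inv, abs_of_pos (by positivity)]
    congr 1
    rw [eq_comm, Real.sqrt_eq_iff_mul_self_eq_of_pos (by positivity), ← mul_pow,
      Real.mul_self_sqrt hlam.le]
  rw [← hconst, ← lintegral_comp_mulVec hB0 (measurable_gaussKer _ _)]
  refine lintegral_mono fun ξ => ?_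
  by_cases h : B.mulVec ξ ⬝ᵥ B.mulVec ξ ≤ ρ
  · have h' : ξ ⬝ᵥ ξ ≤ ρ := by
      refine le_trans (le_of_mul_le_mul_left ?_ hlam) h
      rw [hquad]; exact hle ξ
    rw [gaussKer, gaussKer, Set.indicator_of_mem (by exact h), Set.indicator_of_mem (by exact h'),
      dotProduct_smul_one_mulVec, hquad]
  · rw [gaussKer, Set.indicator_of_notMem (by exact h)]
    exact zero_le

lemma lintegral_gaussKer_one_le {lam : ℝ} (hlam : 0 < lam) :
    ∫⁻ ξ : Fin d → ℝ, gaussKer (lam • 1 : Matrix _ _ ℝ) 1 ξ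
      ≤ ENNReal.ofReal (2 ^ d) * ∫⁻ ξ : Fin d → ℝ, gaussKer (lam • 1 : Matrix _ _ ℝ) (1 / 4) ξ := by
  have hdet : (2 • 1 : Matrix (Fin d) (Fin d) ℝ).det = 2 ^ d := by
    rw [two_smul, ← two_smul ℝ, Matrix.det_smul, Matrix.det_one, mul_one, Fintype.card_fin]
  have h := lintegral_comp_mulVec (C := (2 • 1 : Matrix (Fin d) (Fin d) ℝ))
    (by rw [hdet]; positivity) (measurable_gaussKer (lam • 1 : Matrix _ _ ℝ) 1)
  have e : ∫⁻ ξ : Fin d → ℝ, gaussKer (lam • 1 : Matrix _ _ ℝ) 1 ξ = ENNReal.ofReal (2 ^ d)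
      * ∫⁻ ξ : Fin d → ℝ, gaussKer (lam • 1 : Matrix _ _ ℝ) 1
          ((2 • 1 : Matrix (Fin d) (Fin d) ℝ).mulVec ξ) := by
    rw [h, ← mul_assoc, ← ENNReal.ofReal_mul (by positivity), hdet, abs_of_pos (by positivity),
      mul_inv_cancel₀ (by positivity), ENNReal.ofReal_one, one_mul]
  rw [e]
  refine mul_le_mul_right (lintegral_mono fun ξ => ?_) _
  have e2 : (2 • 1 : Matrix (Fin d) (Fin d) ℝ).mulVec ξ = (2 : ℝ) • ξ := by
    rw [two_smul, ← two_smul ℝ, Matrix.smul_mulVec, Matrix.one_mulVec]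
  have e3 : (2 : ℝ) • ξ ⬝ᵥ (2 : ℝ) • ξ = 4 * (ξ ⬝ᵥ ξ) := by
    rw [dotProduct_smul, smul_dotProduct, smul_eq_mul, smul_eq_mul]; ring
  have h0 := dotProduct_self_nonneg_real ξ
  rw [e2]
  by_cases h : ξ ⬝ᵥ ξ ≤ 1 / 4
  · have h' : (2 : ℝ) • ξ ⬝ᵥ (2 : ℝ) • ξ ≤ 1 := by rw [e3]; linarith
    rw [gaussKer, gaussKer, Set.indicator_of_mem (by exact h'), Set.indicator_of_mem (by exact h),
      dotProduct_smul_one_mulVec, dotProduct_smul_one_mulVec, e3]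
    gcongr
    linarith
  · have h' : ¬ (2 : ℝ) • ξ ⬝ᵥ (2 : ℝ) • ξ ≤ 1 := by rw [e3]; intro h'; apply h; linarith
    rw [gaussKer, Set.indicator_of_notMem (by exact h')]
    exact zero_le

lemma lintegral_gaussKer_ne_zero (A : Matrix (Fin d) (Fin d) ℝ) {ρ : ℝ} (hρ : 0 < ρ) :
    ∫⁻ ξ : Fin d → ℝ, gaussKer A ρ ξ ≠ 0 := by
  rw [gaussKer, lintegral_indicator (measurableSet_ball ρ)]
  have hm : Measurable fun ξ : Fin d → ℝ => ENNReal.ofReal (Real.exp (-(ξ ⬝ᵥ A.mulVec ξ))) :=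
    ENNReal.measurable_ofReal.comp (Real.continuous_exp.comp (continuous_quadForm A).neg).measurable
  rw [ne_eq, lintegral_eq_zero_iff hm]
  intro h
  have hvol : volume {ξ : Fin d → ℝ | ξ ⬝ᵥ ξ ≤ ρ} = 0 := by
    have hfalse : ∀ᵐ _ ∂(volume.restrict {ξ : Fin d → ℝ | ξ ⬝ᵥ ξ ≤ ρ}), False := by
      filter_upwards [h] with ξ hξ
      have := Real.exp_pos (-(ξ ⬝ᵥ A.mulVec ξ))
      simp only [Pi.zero_apply, ENNReal.ofReal_eq_zero] at hξ
      linarith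
    rwa [Filter.eventually_false_iff_eq_bot, ae_eq_bot, Measure.restrict_eq_zero] at hfalse
  have hopen : IsOpen {ξ : Fin d → ℝ | ξ ⬝ᵥ ξ < ρ} :=
    isOpen_lt (continuous_id.dotProduct continuous_id) continuous_const
  refine (hopen.measure_pos volume ⟨0, by simpa using hρ⟩).ne' (measure_mono_null ?_ hvol)
  intro ξ hξ
  exact le_of_lt (show ξ ⬝ᵥ ξ < ρ from hξ)

lemma lintegral_gaussKer_ne_top {A : Matrix (Fin d) (Fin d) ℝ} (hA : A.PosSemidef) (ρ : ℝ) :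
    ∫⁻ ξ : Fin d → ℝ, gaussKer A ρ ξ ≠ ∞ := by
  rw [gaussKer, lintegral_indicator (measurableSet_ball ρ)]
  have hb : Bornology.IsBounded {ξ : Fin d → ℝ | ξ ⬝ᵥ ξ ≤ ρ} := by
    refine (Metric.isBounded_closedBall (x := (0 : Fin d → ℝ)) (r := Real.sqrt ρ)).subset ?_
    intro ξ hξ
    rw [mem_closedBall_zero_iff, pi_norm_le_iff_of_nonneg (Real.sqrt_nonneg _)]
    intro i
    refine Real.le_sqrt_of_sq_le (le_trans ?_ hξ)
    rw [Real.norm_eq_abs, sq_abs, sq]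
    exact Finset.single_le_sum (f := fun i => ξ i * ξ i) (fun i _ => mul_self_nonneg (ξ i))
      (Finset.mem_univ i)
  have h1 : ∫⁻ ξ in {ξ : Fin d → ℝ | ξ ⬝ᵥ ξ ≤ ρ}, ENNReal.ofReal (Real.exp (-(ξ ⬝ᵥ A.mulVec ξ)))
      ≤ ∫⁻ _ in {ξ : Fin d → ℝ | ξ ⬝ᵥ ξ ≤ ρ}, 1 := by
    refine lintegral_mono fun ξ => ?_
    rw [ENNReal.ofReal_le_one, Real.exp_le_one_iff]
    have := hA.dotProduct_mulVec_nonneg ξ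
    simp only [star_trivial] at this
    linarith
  refine (h1.trans_lt ?_).ne
  rw [lintegral_one, Measure.restrict_apply_univ]
  exact hb.measure_lt_top

/-- A Laplace-type lower bound: recentring the tilted Gaussian integral over the unit ball at a
point `ξ₀` of the ball of radius `1/2` leaves a linear term, which can only increase the integral
over a symmetric domain. -/
lemma exp_mul_lintegral_gaussKer_le {A : Matrix (Fin d) (Fin d) ℝ} (hA : A.PosSemidef)
    (s ξ₀ : Fin d → ℝ) (h0 : ξ₀ ⬝ᵥ ξ₀ ≤ 1 / 4) :
    ENNReal.ofReal (Real.exp (s ⬝ᵥ ξ₀ - ξ₀ ⬝ᵥ A.mulVec ξ₀)) * ∫⁻ ξ, gaussKer A (1 / 4) ξ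
      ≤ ∫⁻ ξ, gaussKer A 1 ξ * ENNReal.ofReal (Real.exp (s ⬝ᵥ ξ)) := by
  have hT : A.transpose = A := by simpa [Matrix.IsHermitian] using hA.1
  set q : Fin d → ℝ := s - (2 : ℝ) • A.mulVec ξ₀ with hq
  have hqm : Continuous fun η : Fin d → ℝ => q ⬝ᵥ η := continuous_const.dotProduct continuous_id
  set F : (Fin d → ℝ) → ℝ≥0∞ := fun η => gaussKer A (1 / 4) η * ENNReal.ofReal (Real.exp (q ⬝ᵥ η))
    with hF
  have hFm : Measurable F := (measurable_gaussKer _ _).mul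
    (ENNReal.measurable_ofReal.comp (Real.continuous_exp.comp hqm).measurable)
  -- the linear term can be dropped, by symmetry
  have hsym : ∫⁻ η, gaussKer A (1 / 4) η ≤ ∫⁻ η, F η := by
    have hneg : ∫⁻ η, F (-η) = ∫⁻ η, F η := lintegral_neg_eq_self F
    have h2 : 2 * ∫⁻ η, gaussKer A (1 / 4) η ≤ 2 * ∫⁻ η, F η := by
      calc 2 * ∫⁻ η, gaussKer A (1 / 4) η = ∫⁻ η, 2 * gaussKer A (1 / 4) η :=
            (lintegral_const_mul _ (measurable_gaussKer _ _)).symm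
        _ ≤ ∫⁻ η, (F η + F (-η)) := by
            refine lintegral_mono fun η => ?_
            have e : gaussKer A (1 / 4) (-η) = gaussKer A (1 / 4) η := by
              simp only [gaussKer, Set.indicator_apply, Set.mem_ofPred_eq, neg_dotProduct,
                dotProduct_neg, Matrix.mulVec_neg, neg_neg]
            have e2 : (2 : ℝ≥0∞) ≤ ENNReal.ofReal (Real.exp (q ⬝ᵥ η))
                + ENNReal.ofReal (Real.exp (q ⬝ᵥ (-η))) := by
              rw [← ENNReal.ofReal_add (Real.exp_pos _).le (Real.exp_pos _).le,
                ← ENNReal.ofReal_ofNat]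
              refine ENNReal.ofReal_le_ofReal ?_
              have h1 := Real.add_one_le_exp (q ⬝ᵥ η)
              have h2 := Real.add_one_le_exp (q ⬝ᵥ (-η))
              rw [dotProduct_neg] at h2 ⊢
              linarith
            simp only [hF]
            rw [e, ← mul_add, mul_comm]
            exact mul_le_mul_right e2 _
        _ = 2 * ∫⁻ η, F η := by
            rw [lintegral_add_left hFm, hneg, two_mul]
    exact (ENNReal.mul_le_mul_iff_right two_ne_zero ENNReal.ofNat_ne_top).1 h2
  refine (mul_le_mul_right hsym _).trans ?_
  rw [← lintegral_const_mul _ hFm,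
    ← lintegral_add_right_eq_self (fun ξ => gaussKer A 1 ξ * ENNReal.ofReal (Real.exp (s ⬝ᵥ ξ))) ξ₀]
  refine lintegral_mono fun η => ?_
  by_cases h : η ⬝ᵥ η ≤ 1 / 4
  · have h1 : (η + ξ₀) ⬝ᵥ (η + ξ₀) ≤ 1 := by
      have := dotProduct_self_nonneg_real (η - ξ₀)
      simp only [add_dotProduct, dotProduct_add, sub_dotProduct, dotProduct_sub] at this ⊢
      linarith
    have hcross : η ⬝ᵥ A.mulVec ξ₀ = ξ₀ ⬝ᵥ A.mulVec η := by
      rw [Matrix.dotProduct_mulVec ξ₀, ← Matrix.mulVec_transpose, hT, dotProduct_comm]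
    simp only [hF, gaussKer]
    rw [Set.indicator_of_mem (by exact h), Set.indicator_of_mem (by exact h1),
      ← ENNReal.ofReal_mul (Real.exp_pos _).le, ← ENNReal.ofReal_mul (Real.exp_pos _).le,
      ← ENNReal.ofReal_mul (Real.exp_pos _).le, ← Real.exp_add, ← Real.exp_add, ← Real.exp_add]
    refine le_of_eq ?_
    congr 2
    simp only [hq, Matrix.mulVec_add, add_dotProduct, dotProduct_add, sub_dotProduct,
      smul_dotProduct, smul_eq_mul]
    rw [dotProduct_comm (A.mulVec ξ₀) η, hcross]
    ring
  · simp only [hF, gaussKer]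
    rw [Set.indicator_of_notMem (by exact h)]
    simp

end Gaussian

/-! ### Concentration of the self-normalized noise -/

section Mixture

open scoped ENNReal

variable {d : ℕ} {lam δ : ℝ} {x : ℕ → Vec d} {t : ℕ}

lemma exists_tilt {D : Matrix (Fin d) (Fin d) ℝ} (hD : D.PosDef) (hlam : 0 < lam)
    (hle : ∀ ξ : Fin d → ℝ, lam * (ξ ⬝ᵥ ξ) ≤ ξ ⬝ᵥ D.mulVec ξ) (s : Vec d) :
    ∃ ξ₀ : Fin d → ℝ, ξ₀ ⬝ᵥ ξ₀ ≤ 1 / 4 ∧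
      Real.sqrt lam / 2 * wnorm D⁻¹ s - lam / 4 ≤ s.ofLp ⬝ᵥ ξ₀ - ξ₀ ⬝ᵥ D.mulVec ξ₀ := by
  rcases (wnorm_nonneg D⁻¹ s).eq_or_lt with h0 | h0
  · refine ⟨0, by simp, ?_⟩
    rw [← h0]; simp; linarith
  · set n := wnorm D⁻¹ s with hn
    have hu := (Matrix.isUnit_iff_isUnit_det _).1 hD.isUnit
    have hs : 0 < Real.sqrt lam := Real.sqrt_pos.2 hlam
    have hn2 : s.ofLp ⬝ᵥ D⁻¹.mulVec s.ofLp = n ^ 2 := (wnorm_sq hD.inv.posSemidef s).symm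
    -- the maximizer of the tilted exponent along the direction `D⁻¹ s`
    set ξ₀ : Fin d → ℝ := (Real.sqrt lam / (2 * n)) • D⁻¹.mulVec s.ofLp with hξ
    have e1 : s.ofLp ⬝ᵥ ξ₀ = Real.sqrt lam / 2 * n := by
      rw [hξ, dotProduct_smul, hn2, smul_eq_mul]; field_simp
    have e2 : ξ₀ ⬝ᵥ D.mulVec ξ₀ = lam / 4 := by
      rw [hξ, Matrix.mulVec_smul, Matrix.mulVec_mulVec, Matrix.mul_nonsing_inv _ hu,
        Matrix.one_mulVec, dotProduct_smul, smul_dotProduct, dotProduct_comm, hn2, smul_eq_mul,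
        smul_eq_mul]
      conv_rhs => rw [← Real.mul_self_sqrt hlam.le]
      field_simp; norm_num
    refine ⟨ξ₀, ?_, by rw [e1, e2]⟩
    have := hle ξ₀
    rw [e2] at this
    refine le_of_mul_le_mul_left ?_ hlam
    linarith

/-- A bound on the Gaussian mixture turns into a bound on the self-normalized noise. -/
lemma wnorm_inv_le_of_mixture_lt {w : ℕ → ℝ} (hlam : 0 < lam) (hδ : 0 < δ)
    (hw : ∀ s ∈ Finset.Ico 1 t, 0 ≤ w s) (s : Vec d)
    (h : ∫⁻ ξ, gaussKer (design w lam x t) 1 ξ * ENNReal.ofReal (Real.exp (s.ofLp ⬝ᵥ ξ))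
      < (∫⁻ ξ, gaussKer (lam • 1 : Matrix (Fin d) (Fin d) ℝ) 1 ξ) / ENNReal.ofReal δ) :
    wnorm (design w lam x t)⁻¹ s ≤ Real.sqrt lam / 2 + 2 / Real.sqrt lam
      * Real.log (2 ^ d / δ * Real.sqrt ((design w lam x t).det / lam ^ d)) := by
  set D := design w lam x t with hDdef
  have hD : D.PosDef := design_posDef hw hlam
  have hle : ∀ ξ : Fin d → ℝ, lam * (ξ ⬝ᵥ ξ) ≤ ξ ⬝ᵥ D.mulVec ξ := by
    intro ξ
    have h1 := dotProduct_design w lam x t (WithLp.toLp 2 ξ)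
    have h2 := dotProduct_eq_inner (WithLp.toLp 2 ξ : Vec d) (WithLp.toLp 2 ξ)
    simp only [real_inner_self_eq_norm_sq] at h1 h2
    rw [hDdef, h1, h2]
    linarith [Finset.sum_nonneg fun s hs =>
      mul_nonneg (hw s hs) (sq_nonneg (inner ℝ (x s) (WithLp.toLp 2 ξ : Vec d)))]
  obtain ⟨ξ₀, hξ₀, hf⟩ := exists_tilt hD hlam hle s
  set f := s.ofLp ⬝ᵥ ξ₀ - ξ₀ ⬝ᵥ D.mulVec ξ₀ with hfdef
  have hdet := hD.det_pos
  have hI0 := lintegral_gaussKer_ne_zero (lam • 1 : Matrix (Fin d) (Fin d) ℝ)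
    (show (0 : ℝ) < 1 / 4 by norm_num)
  have hIt := lintegral_gaussKer_ne_top (A := (lam • 1 : Matrix (Fin d) (Fin d) ℝ))
    (Matrix.PosSemidef.one.smul hlam.le) (1 / 4)
  have hZ := lintegral_gaussKer_one_le (d := d) hlam
  have hdetle := ofReal_mul_lintegral_gaussKer_le hD hlam hle (1 / 4)
  have hlap := exp_mul_lintegral_gaussKer_le hD.posSemidef s.ofLp ξ₀ hξ₀
  rw [← hfdef] at hlap
  set I := ∫⁻ ξ, gaussKer (lam • 1 : Matrix (Fin d) (Fin d) ℝ) (1 / 4) ξ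
  have hchain : ENNReal.ofReal (Real.exp f * Real.sqrt (lam ^ d / D.det)) * I
      ≤ ENNReal.ofReal (2 ^ d / δ) * I := by
    rw [ENNReal.ofReal_mul (Real.exp_pos _).le, mul_assoc]
    refine (mul_le_mul_right hdetle _).trans (hlap.trans (h.le.trans ?_))
    refine (ENNReal.div_le_div_right hZ _).trans (le_of_eq ?_)
    rw [ENNReal.ofReal_div_of_pos hδ, ENNReal.div_eq_inv_mul, ENNReal.div_eq_inv_mul, mul_assoc]
  have hreal : Real.exp f * Real.sqrt (lam ^ d / D.det) ≤ 2 ^ d / δ :=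
    (ENNReal.ofReal_le_ofReal_iff (by positivity)).1
      ((ENNReal.mul_le_mul_iff_left hI0 hIt).1 hchain)
  have hsq : 0 < Real.sqrt (D.det / lam ^ d) := Real.sqrt_pos.2 (by positivity)
  have hexp : Real.exp f ≤ 2 ^ d / δ * Real.sqrt (D.det / lam ^ d) := by
    have e : Real.sqrt (lam ^ d / D.det) * Real.sqrt (D.det / lam ^ d) = 1 := by
      rw [← Real.sqrt_mul (by positivity), div_mul_div_cancel₀ hdet.ne',
        div_self (by positivity), Real.sqrt_one]
    calc Real.exp f
        = Real.exp f * Real.sqrt (lam ^ d / D.det) * Real.sqrt (D.det / lam ^ d) := by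
          rw [mul_assoc, e, mul_one]
      _ ≤ _ := mul_le_mul_of_nonneg_right hreal hsq.le
  have hlog := (Real.le_log_iff_exp_le (by positivity)).2 hexp
  have hs : 0 < Real.sqrt lam := Real.sqrt_pos.2 hlam
  have hfin : Real.sqrt lam / 2 * wnorm D⁻¹ s
      ≤ lam / 4 + Real.log (2 ^ d / δ * Real.sqrt (D.det / lam ^ d)) := by linarith
  calc wnorm D⁻¹ s = 2 / Real.sqrt lam * (Real.sqrt lam / 2 * wnorm D⁻¹ s) := by field_simp
    _ ≤ 2 / Real.sqrt lam
        * (lam / 4 + Real.log (2 ^ d / δ * Real.sqrt (D.det / lam ^ d))) :=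
        mul_le_mul_of_nonneg_left hfin (by positivity)
    _ = _ := by
        rw [mul_add]
        congr 1
        nth_rewrite 2 [← Real.mul_self_sqrt hlam.le]
        field_simp; norm_num

lemma sqrt_det_design_le {w : ℕ → ℝ} (hd : 1 ≤ d) (hlam : 0 < lam)
    (hw : ∀ s ∈ Finset.Ico 1 t, 0 ≤ w s) (hK : ∀ s ∈ Finset.Ico 1 t, w s * ‖x s‖ ^ 2 ≤ L) :
    Real.sqrt ((design w lam x t).det / lam ^ d) ≤ (1 + L * t / (d * lam)) ^ ((d : ℝ) / 2) := by
  have h := det_design_le hd hw hlam hK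
  have hd0 : (0 : ℝ) < d := by exact_mod_cast hd
  have hL : (0 : ℝ) ≤ L := by norm_num [L]
  have hle : (1 + L * ((t - 1 : ℕ) : ℝ) / (d * lam)) ^ d ≤ (1 + L * t / (d * lam)) ^ d := by
    have : ((t - 1 : ℕ) : ℝ) ≤ t := by exact_mod_cast Nat.sub_le t 1
    gcongr
  have h0 : (0 : ℝ) ≤ 1 + L * t / (d * lam) := by positivity
  rw [div_eq_mul_one_div (d : ℝ) 2, Real.rpow_mul h0, Real.rpow_natCast, ← Real.sqrt_eq_rpow]
  refine Real.sqrt_le_sqrt ?_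
  rw [div_le_iff₀ (by positivity)]
  have hl : 0 < lam ^ d := by positivity
  nlinarith [mul_le_mul_of_nonneg_left hle hl.le]

/-- The centred and weighted sum of rewards. -/
def noiseSum (x : ℕ → Vec d) (r : ℕ → ℝ) (θ : Vec d) (t : ℕ) : Vec d :=
  ∑ s ∈ Finset.Ico 1 t, (r (s + 1) - mu (inner ℝ (x s) θ)) • x s

/-- The exponent of the exponential supermartingale in the direction `ξ`. -/
def expo (x : ℕ → Vec d) (r : ℕ → ℝ) (θ : Vec d) (t : ℕ) (ξ : Fin d → ℝ) : ℝ :=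
  ∑ s ∈ Finset.Ico 1 t, ((r (s + 1) - mu (inner ℝ (x s) θ)) * ((x s).ofLp ⬝ᵥ ξ)
    - muDot (inner ℝ (x s) θ) * ((x s).ofLp ⬝ᵥ ξ) ^ 2)

/-- The mixture of the exponential supermartingales over a truncated Gaussian prior. -/
def mixture (lam : ℝ) (x : ℕ → Vec d) (r : ℕ → ℝ) (θ : Vec d) (t : ℕ) : ℝ≥0∞ :=
  ∫⁻ ξ, gaussKer (lam • 1 : Matrix (Fin d) (Fin d) ℝ) 1 ξ
    * ENNReal.ofReal (Real.exp (expo x r θ t ξ))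

lemma mixture_eq (lam : ℝ) (x : ℕ → Vec d) (r : ℕ → ℝ) (θ : Vec d) (t : ℕ) :
    mixture lam x r θ t = ∫⁻ ξ, gaussKer (H lam x t θ) 1 ξ
      * ENNReal.ofReal (Real.exp ((noiseSum x r θ t).ofLp ⬝ᵥ ξ)) := by
  refine lintegral_congr fun ξ => ?_
  by_cases h : ξ ⬝ᵥ ξ ≤ 1
  · rw [gaussKer, gaussKer, Set.indicator_of_mem (by exact h), Set.indicator_of_mem (by exact h),
      ← ENNReal.ofReal_mul (Real.exp_pos _).le, ← ENNReal.ofReal_mul (Real.exp_pos _).le,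
      ← Real.exp_add, ← Real.exp_add]
    congr 2
    have h1 := dotProduct_design (fun s => muDot (inner ℝ (x s) θ)) lam x t (WithLp.toLp 2 ξ)
    have h2 := dotProduct_eq_inner (WithLp.toLp 2 ξ : Vec d) (WithLp.toLp 2 ξ)
    rw [real_inner_self_eq_norm_sq] at h2
    simp only [← dotProduct_eq_inner _ (WithLp.toLp 2 ξ : Vec d)] at h1
    rw [H_eq_design, h1, dotProduct_smul_one_mulVec, ← h2, noiseSum, expo,
      Finset.sum_sub_distrib, WithLp.ofLp_sum, sum_dotProduct]
    simp only [WithLp.ofLp_smul, smul_dotProduct, smul_eq_mul]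
    ring
  · rw [gaussKer, gaussKer, Set.indicator_of_notMem (by exact h),
      Set.indicator_of_notMem (by exact h), zero_mul, zero_mul]

lemma mixture_one (lam : ℝ) (x : ℕ → Vec d) (r : ℕ → ℝ) (θ : Vec d) :
    mixture lam x r θ 1 = ∫⁻ ξ, gaussKer (lam • 1 : Matrix (Fin d) (Fin d) ℝ) 1 ξ := by
  simp [mixture, expo]

/-- When the mixture has stayed below its threshold, the true parameter satisfies the confidence
inequality. -/
lemma crit_le_of_mixture_lt {S : ℝ} {r : ℕ → ℝ} {θ θh : Vec d} (hd : 1 ≤ d) (hlam : 0 < lam)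
    (hδ : 0 < δ) (hx : ∀ s ≥ 1, ‖x s‖ ≤ 1) (hθ : ‖θ‖ ≤ S)
    (hmax : IsMaxOn (logLik lam x r t) Set.univ θh)
    (h : mixture lam x r θ t
      < (∫⁻ ξ, gaussKer (lam • 1 : Matrix (Fin d) (Fin d) ℝ) 1 ξ) / ENNReal.ofReal δ) :
    crit lam x t θh θ ≤ gam d lam S δ t := by
  have hs : 0 < Real.sqrt lam := Real.sqrt_pos.2 hlam
  have hw : ∀ s ∈ Finset.Ico 1 t, 0 ≤ muDot (inner ℝ (x s) θ) := fun s _ => (muDot_pos _).le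
  rw [mixture_eq, H_eq_design] at h
  have h1 := wnorm_inv_le_of_mixture_lt hlam hδ hw _ h
  have h2 := sqrt_det_design_le (x := x) (t := t) hd hlam hw fun s hs => by
    have := pow_le_one₀ (n := 2) (norm_nonneg _) (hx s (Finset.mem_Ico.1 hs).1)
    calc muDot (inner ℝ (x s) θ) * ‖x s‖ ^ 2 ≤ L * 1 :=
          mul_le_mul (muDot_le _) this (sq_nonneg _) (by norm_num [L])
      _ = L := mul_one _
  have hdet := (design_posDef (x := x) hw hlam).det_pos
  have h3 : Real.log (2 ^ d / δ * Real.sqrt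
        ((design (fun s => muDot (inner ℝ (x s) θ)) lam x t).det / lam ^ d))
      ≤ Real.log (2 ^ d / δ * (1 + L * t / (d * lam)) ^ ((d : ℝ) / 2)) := by
    gcongr
  have e : g lam x t θ - g lam x t θh = lam • θ - noiseSum x r θ t := by
    rw [g_eq_of_isMaxOn hmax, g, noiseSum]
    simp only [sub_smul, Finset.sum_sub_distrib]
    abel
  have h4 := wnorm_inv_sub_le (H_posDef hlam x t θ) (lam • θ) (noiseSum x r θ t)
  have h5 : wnorm (H lam x t θ)⁻¹ (lam • θ) ≤ Real.sqrt lam * S := by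
    rw [H_eq_design]
    refine (wnorm_design_inv_le hw hlam _).trans ?_
    rw [norm_smul, Real.norm_eq_abs, abs_of_pos hlam, div_le_iff₀ hs]
    have : Real.sqrt lam * S * Real.sqrt lam = lam * S := by
      rw [mul_right_comm, Real.mul_self_sqrt hlam.le]
    rw [this]
    exact mul_le_mul_of_nonneg_left hθ hlam.le
  rw [crit, e, gam]
  rw [← H_eq_design] at h1
  have h6 := mul_le_mul_of_nonneg_left h3 (show 0 ≤ 2 / Real.sqrt lam by positivity)
  simp only [← H_eq_design] at h6
  linarith

end Mixture

/-! ### Ville's inequality and the exponential supermartingale step -/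

section Probability

open scoped ENNReal

variable {Ω : Type*} {m0 : MeasurableSpace Ω} {P : Measure Ω}

/-- **Ville's inequality** over finitely many rounds, for a process whose integrals over the
events of each round do not increase at the next round. -/
lemma ville {F : ℕ → MeasurableSpace Ω} (hF : Monotone F) (hF0 : ∀ t, F t ≤ m0)
    {N : ℕ → Ω → ℝ≥0∞} (hN : ∀ t ≥ 1, Measurable[F t] (N t))
    (hstep : ∀ t ≥ 1, ∀ A, MeasurableSet[F t] A → ∫⁻ ω in A, N (t + 1) ω ∂P ≤ ∫⁻ ω in A, N t ω ∂P)
    (c : ℝ≥0∞) {T : ℕ} (hT : 1 ≤ T) :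
    c * P {ω | ∀ t ∈ Finset.Icc 1 T, N t ω < c}ᶜ ≤ ∫⁻ ω, N 1 ω ∂P := by
  have hB : ∀ T, MeasurableSet[F T] {ω | ∀ t ∈ Finset.Icc 1 T, N t ω < c} := by
    intro T
    have e : {ω | ∀ t ∈ Finset.Icc 1 T, N t ω < c}
        = ⋂ t ∈ Finset.Icc 1 T, {ω | N t ω < c} := by ext; simp
    rw [e]
    refine Finset.measurableSet_biInter _ fun t ht => ?_
    have ht' := Finset.mem_Icc.1 ht
    exact hF ht'.2 _ (measurableSet_lt (hN t ht'.1) measurable_const)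
  have hmN : ∀ t ≥ 1, Measurable[m0] (N t) := fun t ht => (hN t ht).mono (hF0 t) le_rfl
  -- one round: the part of the event where the threshold is crossed is paid for by Markov
  have hsplit : ∀ t ≥ 1, ∀ A, MeasurableSet[m0] A →
      c * P (A ∩ {ω | c ≤ N t ω}) + ∫⁻ ω in A ∩ {ω | N t ω < c}, N t ω ∂P
        ≤ ∫⁻ ω in A, N t ω ∂P := by
    intro t ht A hA
    have hlt : MeasurableSet {ω | N t ω < c} := measurableSet_lt (hmN t ht) measurable_const
    have hge : MeasurableSet {ω | c ≤ N t ω} := measurableSet_le measurable_const (hmN t ht)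
    have e : A \ {ω | N t ω < c} = A ∩ {ω | c ≤ N t ω} := by ext; simp
    rw [← lintegral_inter_add_sdiff _ A hlt, add_comm, e]
    refine add_le_add le_rfl ?_
    rw [← setLIntegral_const]
    exact setLIntegral_mono (hmN t ht) fun ω hω => hω.2
  have key : ∀ T ≥ 1, c * P {ω | ∀ t ∈ Finset.Icc 1 T, N t ω < c}ᶜ
      + ∫⁻ ω in {ω | ∀ t ∈ Finset.Icc 1 T, N t ω < c}, N T ω ∂P ≤ ∫⁻ ω, N 1 ω ∂P := by
    intro T hT
    induction T, hT using Nat.le_induction with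
    | base =>
      have h := hsplit 1 le_rfl Set.univ MeasurableSet.univ
      rw [setLIntegral_univ, Set.univ_inter, Set.univ_inter] at h
      have e1 : {ω | ∀ t ∈ Finset.Icc 1 1, N t ω < c} = {ω | N 1 ω < c} := by ext; simp
      have e2 : {ω | N 1 ω < c}ᶜ = {ω | c ≤ N 1 ω} := by ext; simp
      rwa [e1, e2]
    | succ n hn ih =>
      refine le_trans ?_ ih
      set B := {ω | ∀ t ∈ Finset.Icc 1 n, N t ω < c} with hBn
      have e1 : {ω | ∀ t ∈ Finset.Icc 1 (n + 1), N t ω < c} = B ∩ {ω | N (n + 1) ω < c} := by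
        ext ω
        simp only [hBn, Set.mem_ofPred_eq, Set.mem_inter_iff, Finset.mem_Icc]
        constructor
        · intro h
          exact ⟨fun t ht => h t ⟨ht.1, by omega⟩, h _ ⟨by omega, le_rfl⟩⟩
        · rintro ⟨h1, h2⟩ t ht
          rcases Nat.lt_or_ge n t with h | h
          · rwa [show t = n + 1 by omega]
          · exact h1 t ⟨ht.1, h⟩
      have e2 : (B ∩ {ω | N (n + 1) ω < c})ᶜ ⊆ Bᶜ ∪ (B ∩ {ω | c ≤ N (n + 1) ω}) := by
        intro ω hω
        by_cases hb : ω ∈ B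
        · refine Or.inr ⟨hb, ?_⟩
          exact le_of_not_gt fun h : N (n + 1) ω < c => hω ⟨hb, h⟩
        · exact Or.inl hb
      have h1 := hsplit (n + 1) (by omega) B (hF0 n _ (hB n))
      have h2 := hstep n hn B (hB n)
      rw [e1]
      calc c * P (B ∩ {ω | N (n + 1) ω < c})ᶜ
            + ∫⁻ ω in B ∩ {ω | N (n + 1) ω < c}, N (n + 1) ω ∂P
          ≤ c * (P Bᶜ + P (B ∩ {ω | c ≤ N (n + 1) ω}))
            + ∫⁻ ω in B ∩ {ω | N (n + 1) ω < c}, N (n + 1) ω ∂P := by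
            gcongr
            exact (measure_mono e2).trans (measure_union_le _ _)
        _ = c * P Bᶜ + (c * P (B ∩ {ω | c ≤ N (n + 1) ω})
            + ∫⁻ ω in B ∩ {ω | N (n + 1) ω < c}, N (n + 1) ω ∂P) := by ring
        _ ≤ _ := by gcongr; exact h1.trans h2
  exact le_self_add.trans (key T hT)

/-- One step of the exponential supermartingale: conditionally on `G`, the variable `ρ` is
Bernoulli with parameter `p`. -/
lemma integral_bernoulli_step_le [IsProbabilityMeasure P] {G : MeasurableSpace Ω} (hG : G ≤ m0)
    {Y a p ρ : Ω → ℝ} {K : ℝ} (hY : Measurable[G] Y) (hY0 : ∀ ω, 0 ≤ Y ω) (hYK : ∀ ω, Y ω ≤ K)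
    (ha : Measurable[G] a) (ha1 : ∀ ω, |a ω| ≤ 1) (hp : Measurable[G] p) (hp0 : ∀ ω, 0 ≤ p ω)
    (hp1 : ∀ ω, p ω ≤ 1) (hρ : Measurable[m0] ρ) (hρ01 : ∀ ω, ρ ω = 0 ∨ ρ ω = 1)
    (hcond : P[ρ | G] =ᵐ[P] p) :
    ∫ ω, Y ω * Real.exp (a ω * (ρ ω - p ω) - p ω * (1 - p ω) * a ω ^ 2) ∂P ≤ ∫ ω, Y ω ∂P := by
  set W : Ω → ℝ := fun ω => Y ω * Real.exp (-(p ω * (1 - p ω) * a ω ^ 2)) with hW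
  set e₁ : Ω → ℝ := fun ω => Real.exp (a ω * (1 - p ω)) with he1
  set e₀ : Ω → ℝ := fun ω => Real.exp (a ω * (0 - p ω)) with he0
  have hWm : Measurable[G] W := hY.mul
    (Real.measurable_exp.comp ((hp.mul (measurable_const.sub hp)).mul (ha.pow_const 2)).neg)
  have he1m : Measurable[G] e₁ := Real.measurable_exp.comp (ha.mul (measurable_const.sub hp))
  have he0m : Measurable[G] e₀ := Real.measurable_exp.comp (ha.mul (measurable_const.sub hp))
  have hW0 : ∀ ω, 0 ≤ W ω := fun ω => mul_nonneg (hY0 ω) (Real.exp_pos _).le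
  have hvar : ∀ ω, 0 ≤ p ω * (1 - p ω) * a ω ^ 2 := fun ω =>
    mul_nonneg (mul_nonneg (hp0 ω) (sub_nonneg.2 (hp1 ω))) (sq_nonneg _)
  have hWK : ∀ ω, W ω ≤ K := fun ω => by
    have := Real.exp_le_one_iff.2 (neg_nonpos.2 (hvar ω))
    exact (mul_le_of_le_one_right (hY0 ω) this).trans (hYK ω)
  have hK : ∀ ω, 0 ≤ K := fun ω => (hY0 ω).trans (hYK ω)
  have he1K : ∀ ω, e₁ ω ≤ Real.exp 1 := fun ω => by
    refine Real.exp_le_exp.2 ?_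
    have h1 := (abs_le.1 (ha1 ω)).2
    nlinarith [hp0 ω, hp1 ω]
  have he0K : ∀ ω, e₀ ω ≤ Real.exp 1 := fun ω => by
    refine Real.exp_le_exp.2 ?_
    have h1 := (abs_le.1 (ha1 ω)).1
    nlinarith [hp0 ω, hp1 ω]
  have hprod : ∀ (e : Ω → ℝ), (∀ ω, 0 ≤ e ω) → (∀ ω, e ω ≤ Real.exp 1) → ∀ ω,
      ‖W ω * e ω‖ ≤ K * Real.exp 1 := fun e h0 h1 ω => by
    rw [Real.norm_eq_abs, abs_of_nonneg (mul_nonneg (hW0 ω) (h0 ω))]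
    exact mul_le_mul (hWK ω) (h1 ω) (h0 ω) (hK ω)
  have hp1e := hprod e₁ (fun ω => (Real.exp_pos _).le) he1K
  have hp0e := hprod e₀ (fun ω => (Real.exp_pos _).le) he0K
  have hi1 : Integrable (fun ω => W ω * e₁ ω) P :=
    Integrable.of_bound ((hWm.mul he1m).mono hG le_rfl).aestronglyMeasurable _
      (Filter.Eventually.of_forall hp1e)
  have hi0 : Integrable (fun ω => W ω * e₀ ω) P :=
    Integrable.of_bound ((hWm.mul he0m).mono hG le_rfl).aestronglyMeasurable _
      (Filter.Eventually.of_forall hp0e)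
  set U : Ω → ℝ := fun ω => W ω * e₁ ω - W ω * e₀ ω with hU
  have hUm : Measurable[G] U := (hWm.mul he1m).sub (hWm.mul he0m)
  have hUi : Integrable U P := hi1.sub hi0
  have hρb : ∀ ω, ‖ρ ω‖ ≤ 1 := fun ω => by rcases hρ01 ω with h | h <;> simp [h]
  have hpb : ∀ ω, ‖p ω‖ ≤ 1 := fun ω => by
    rw [Real.norm_eq_abs, abs_of_nonneg (hp0 ω)]; exact hp1 ω
  have hρi : Integrable ρ P := Integrable.of_bound hρ.aestronglyMeasurable 1
    (Filter.Eventually.of_forall hρb)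
  have hUρ : Integrable (U * ρ) P := by
    have := hUi.bdd_mul hρ.aestronglyMeasurable (Filter.Eventually.of_forall hρb)
    refine this.congr (Filter.Eventually.of_forall fun ω => ?_)
    exact mul_comm _ _
  have hUp : Integrable (fun ω => U ω * p ω) P := by
    have := hUi.bdd_mul (hp.mono hG le_rfl).aestronglyMeasurable (Filter.Eventually.of_forall hpb)
    refine this.congr (Filter.Eventually.of_forall fun ω => ?_)
    exact mul_comm _ _
  have hpull : ∫ ω, U ω * ρ ω ∂P = ∫ ω, U ω * p ω ∂P := by
    have h1 := condExp_mul_of_stronglyMeasurable_left hUm.stronglyMeasurable hUρ hρi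
    calc ∫ ω, U ω * ρ ω ∂P = ∫ ω, (P[U * ρ | G]) ω ∂P := (integral_condExp hG).symm
      _ = ∫ ω, U ω * p ω ∂P := by
          refine integral_congr_ae ?_
          filter_upwards [h1, hcond] with ω h2 h3
          rw [h2, Pi.mul_apply, h3]
  have hYi : Integrable Y P := Integrable.of_bound (hY.mono hG le_rfl).aestronglyMeasurable K
    (Filter.Eventually.of_forall fun ω => by
      rw [Real.norm_eq_abs, abs_of_nonneg (hY0 ω)]; exact hYK ω)
  calc ∫ ω, Y ω * Real.exp (a ω * (ρ ω - p ω) - p ω * (1 - p ω) * a ω ^ 2) ∂P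
      = ∫ ω, (W ω * e₀ ω + U ω * ρ ω) ∂P := by
        refine integral_congr_ae (Filter.Eventually.of_forall fun ω => ?_)
        simp only [hW, hU, he0, he1]
        rw [sub_eq_add_neg (a ω * (ρ ω - p ω)), Real.exp_add]
        rcases hρ01 ω with h | h <;> rw [h] <;> ring
    _ = ∫ ω, (W ω * e₀ ω + U ω * p ω) ∂P := by
        rw [integral_add hi0 hUp, ← hpull]; exact integral_add hi0 hUρ
    _ ≤ ∫ ω, Y ω ∂P := by
        refine integral_mono (hi0.add hUp) hYi fun ω => ?_
        have h1 := bernoulli_mgf_le (hp0 ω) (hp1 ω) (ha1 ω)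
        have h2 := mul_le_mul_of_nonneg_left h1 (hW0 ω)
        have h3 : W ω * Real.exp (p ω * (1 - p ω) * a ω ^ 2) = Y ω := by
          simp only [hW]
          rw [mul_assoc, ← Real.exp_add, neg_add_cancel, Real.exp_zero, mul_one]
        simp only [hU]
        rw [h3] at h2
        linarith

end Probability

/-! ### The confidence event and the regret bound -/

section Trajectory

open scoped ENNReal

variable {d : ℕ}

lemma measurable_expo {Ω' : Type*} [MeasurableSpace Ω'] {x : ℕ → Ω' → Vec d} {r : ℕ → Ω' → ℝ}
    (θ : Vec d) {t : ℕ} (hx : ∀ s ∈ Finset.Ico 1 t, Measurable (x s))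
    (hr : ∀ s ∈ Finset.Ico 1 t, Measurable (r (s + 1))) :
    Measurable fun p : (Fin d → ℝ) × Ω' =>
      expo (fun s => x s p.2) (fun s => r s p.2) θ t p.1 := by
  refine Finset.measurable_sum _ fun s hs => ?_
  have h1 : Measurable fun p : (Fin d → ℝ) × Ω' => x s p.2 := (hx s hs).comp measurable_snd
  have h2 : Measurable fun p : (Fin d → ℝ) × Ω' => r (s + 1) p.2 := (hr s hs).comp measurable_snd
  have h3 : Measurable fun p : (Fin d → ℝ) × Ω' => (x s p.2).ofLp ⬝ᵥ p.1 := by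
    have hc : Continuous fun q : Vec d × (Fin d → ℝ) => q.1.ofLp ⬝ᵥ q.2 :=
      ((PiLp.continuous_ofLp 2 _).comp continuous_fst).dotProduct continuous_snd
    exact hc.measurable.comp (h1.prodMk measurable_fst)
  have h4 : Measurable fun p : (Fin d → ℝ) × Ω' => (inner ℝ (x s p.2) θ : ℝ) :=
    h1.inner measurable_const
  exact ((h2.sub (continuous_mu.measurable.comp h4)).mul h3).sub
    ((continuous_muDot.measurable.comp h4).mul (h3.pow_const 2))

lemma measurable_mixture_integrand {Ω' : Type*} [MeasurableSpace Ω'] {x : ℕ → Ω' → Vec d}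
    {r : ℕ → Ω' → ℝ} (lam : ℝ) (θ : Vec d) {t : ℕ}
    (hx : ∀ s ∈ Finset.Ico 1 t, Measurable (x s))
    (hr : ∀ s ∈ Finset.Ico 1 t, Measurable (r (s + 1))) :
    Measurable fun p : (Fin d → ℝ) × Ω' => gaussKer (lam • 1 : Matrix (Fin d) (Fin d) ℝ) 1 p.1
      * ENNReal.ofReal (Real.exp (expo (fun s => x s p.2) (fun s => r s p.2) θ t p.1)) :=
  ((measurable_gaussKer _ _).comp measurable_fst).mul
    (ENNReal.measurable_ofReal.comp (Real.measurable_exp.comp (measurable_expo θ hx hr)))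

lemma measurable_mixture {Ω' : Type*} [MeasurableSpace Ω'] {x : ℕ → Ω' → Vec d}
    {r : ℕ → Ω' → ℝ} (lam : ℝ) (θ : Vec d) {t : ℕ}
    (hx : ∀ s ∈ Finset.Ico 1 t, Measurable (x s))
    (hr : ∀ s ∈ Finset.Ico 1 t, Measurable (r (s + 1))) :
    Measurable fun ω => mixture lam (fun s => x s ω) (fun s => r s ω) θ t :=
  (measurable_mixture_integrand lam θ hx hr).lintegral_prod_left'

lemma abs_dotProduct_le_one {u : Vec d} {ξ : Fin d → ℝ} (hu : ‖u‖ ≤ 1) (hξ : ξ ⬝ᵥ ξ ≤ 1) :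
    |u.ofLp ⬝ᵥ ξ| ≤ 1 := by
  have e := dotProduct_eq_inner u (WithLp.toLp 2 ξ)
  have e2 := dotProduct_eq_inner (WithLp.toLp 2 ξ : Vec d) (WithLp.toLp 2 ξ)
  rw [real_inner_self_eq_norm_sq] at e2
  simp only at e e2
  rw [e]
  refine (abs_real_inner_le_norm _ _).trans ?_
  have h1 : ‖(WithLp.toLp 2 ξ : Vec d)‖ ≤ 1 := by
    rw [e2] at hξ
    exact (sq_le_one_iff₀ (norm_nonneg _)).1 hξ
  exact mul_le_one₀ hu (norm_nonneg _) h1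

section Past

variable {Ω : Type*}

lemma comap_le_past (F0 : MeasurableSpace Ω) (x : ℕ → Ω → Vec d) (r : ℕ → Ω → ℝ) {s t : ℕ}
    (hs : s ∈ Finset.Ico 1 t) :
    MeasurableSpace.comap (x s) inferInstance ⊔ MeasurableSpace.comap (r (s + 1)) inferInstance
      ≤ past F0 x r t :=
  le_sup_of_le_right (le_iSup₂_of_le s hs le_rfl)

lemma measurable_arm_past (F0 : MeasurableSpace Ω) (x : ℕ → Ω → Vec d) (r : ℕ → Ω → ℝ) {s t : ℕ}
    (hs : s ∈ Finset.Ico 1 t) : Measurable[past F0 x r t] (x s) :=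
  measurable_iff_comap_le.2 (le_sup_left.trans (comap_le_past F0 x r hs))

lemma measurable_reward_past (F0 : MeasurableSpace Ω) (x : ℕ → Ω → Vec d) (r : ℕ → Ω → ℝ)
    {s t : ℕ} (hs : s ∈ Finset.Ico 1 t) : Measurable[past F0 x r t] (r (s + 1)) :=
  measurable_iff_comap_le.2 (le_sup_right.trans (comap_le_past F0 x r hs))

lemma past_mono (F0 : MeasurableSpace Ω) (x : ℕ → Ω → Vec d) (r : ℕ → Ω → ℝ) :
    Monotone (past F0 x r) := fun _ _ h =>
  sup_le le_sup_left (iSup₂_le fun _ hs =>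
    comap_le_past F0 x r (Finset.Ico_subset_Ico_right h hs))

lemma measurable_exp_expo (F0 : MeasurableSpace Ω) (x : ℕ → Ω → Vec d) (r : ℕ → Ω → ℝ)
    (θ : Vec d) (t : ℕ) (ξ : Fin d → ℝ) : Measurable[past F0 x r t] fun ω =>
      Real.exp (expo (fun s => x s ω) (fun s => r s ω) θ t ξ) :=
  letI := past F0 x r t
  Real.measurable_exp.comp ((measurable_expo θ (fun _ hs => measurable_arm_past F0 x r hs)
    (fun _ hs => measurable_reward_past F0 x r hs)).comp
    (measurable_const.prodMk measurable_id))

end Past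

variable {Ω : Type*} [mΩ : MeasurableSpace Ω] {P : Measure Ω}

lemma Bandit.past_le (b : Bandit d Ω P) (t : ℕ) : past b.F0 b.x b.r t ≤ mΩ :=
  sup_le b.F0_le (iSup₂_le fun s _ =>
    sup_le (b.x_measurable s).comap_le (b.r_measurable (s + 1)).comap_le)

/-- The information available when the reward of round `t` is drawn: the past and the arm. -/
abbrev Bandit.preReward (b : Bandit d Ω P) (t : ℕ) : MeasurableSpace Ω :=
  past b.F0 b.x b.r t ⊔ MeasurableSpace.comap (b.x t) inferInstance

/-- The exponent of the supermartingale along the trajectory of outcome `ω`. -/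
def Bandit.pathExpo (b : Bandit d Ω P) (t : ℕ) (ξ : Fin d → ℝ) (ω : Ω) : ℝ :=
  expo (fun s => b.x s ω) (fun s => b.r s ω) b.θstar t ξ

lemma Bandit.pathExpo_le (b : Bandit d Ω P) (t : ℕ) {ξ : Fin d → ℝ} (hξ : ξ ⬝ᵥ ξ ≤ 1) (ω : Ω) :
    b.pathExpo t ξ ω ≤ t := by
  have h : ∀ s ∈ Finset.Ico 1 t,
      (b.r (s + 1) ω - mu (inner ℝ (b.x s ω) b.θstar)) * ((b.x s ω).ofLp ⬝ᵥ ξ)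
        - muDot (inner ℝ (b.x s ω) b.θstar) * ((b.x s ω).ofLp ⬝ᵥ ξ) ^ 2 ≤ 1 := by
    intro s hs
    have hs1 := (Finset.mem_Ico.1 hs).1
    have h1 := abs_dotProduct_le_one (b.arms_norm_le s hs1 ω _ (b.x_mem s hs1 ω)) hξ
    have h2 : |b.r (s + 1) ω - mu (inner ℝ (b.x s ω) b.θstar)| ≤ 1 := by
      have h3 := mu_pos (inner ℝ (b.x s ω) b.θstar)
      have h4 := mu_lt_one (inner ℝ (b.x s ω) b.θstar)
      rw [abs_le]
      rcases b.r_binary s hs1 ω with h | h <;> rw [h] <;> constructor <;> linarith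
    have h5 := mul_le_one₀ h2 (abs_nonneg _) h1
    rw [← abs_mul] at h5
    have h6 := mul_nonneg (muDot_pos (inner ℝ (b.x s ω) b.θstar)).le
      (sq_nonneg ((b.x s ω).ofLp ⬝ᵥ ξ))
    linarith [le_abs_self ((b.r (s + 1) ω - mu (inner ℝ (b.x s ω) b.θstar))
      * ((b.x s ω).ofLp ⬝ᵥ ξ))]
  have h1 := Finset.sum_le_card_nsmul _ _ _ h
  rw [Nat.card_Ico, nsmul_eq_mul, mul_one] at h1
  exact h1.trans (by exact_mod_cast Nat.sub_le t 1)

/-- The exponential process in a direction `ξ` of the unit ball is a supermartingale. -/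
lemma Bandit.setLIntegral_exp_step (b : Bandit d Ω P) [IsProbabilityMeasure P] {t : ℕ}
    (ht : 1 ≤ t) {ξ : Fin d → ℝ} (hξ : ξ ⬝ᵥ ξ ≤ 1) {A : Set Ω}
    (hA : MeasurableSet[past b.F0 b.x b.r t] A) :
    ∫⁻ ω in A, ENNReal.ofReal (Real.exp (b.pathExpo (t + 1) ξ ω)) ∂P
      ≤ ∫⁻ ω in A, ENNReal.ofReal (Real.exp (b.pathExpo t ξ ω)) ∂P := by
  have hG : b.preReward t ≤ mΩ := sup_le (b.past_le t) (b.x_measurable t).comap_le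
  have hAG : MeasurableSet[b.preReward t] A :=
    (le_sup_left : past b.F0 b.x b.r t ≤ b.preReward t) A hA
  have hxG : Measurable[b.preReward t] (b.x t) := measurable_iff_comap_le.2 le_sup_right
  have hE : ∀ n, Measurable[past b.F0 b.x b.r n] (fun ω => Real.exp (b.pathExpo n ξ ω)) :=
    fun n => measurable_exp_expo b.F0 b.x b.r b.θstar n ξ
  have hArm := b.x_mem t ht
  have hp : Measurable[b.preReward t] fun ω => mu (inner ℝ (b.x t ω) b.θstar) :=
    continuous_mu.measurable.comp (hxG.inner measurable_const)
  have ha : Measurable[b.preReward t] fun ω => (b.x t ω).ofLp ⬝ᵥ ξ := by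
    have hc : Continuous fun u : Vec d => u.ofLp ⬝ᵥ ξ :=
      (PiLp.continuous_ofLp 2 _).dotProduct continuous_const
    exact hc.measurable.comp hxG
  have hcond : P[b.r (t + 1) | b.preReward t] =ᵐ[P] fun ω => mu (inner ℝ (b.x t ω) b.θstar) := by
    have e : Set.indicator {ω | b.r (t + 1) ω = 1} (fun _ => (1 : ℝ)) = b.r (t + 1) := by
      funext ω
      rcases b.r_binary t ht ω with h | h <;> simp [h]
    rw [← e]
    exact b.reward_law t ht
  have hstep := integral_bernoulli_step_le (P := P) hG (K := Real.exp t)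
    (Y := A.indicator fun ω => Real.exp (b.pathExpo t ξ ω))
    (((hE t).mono le_sup_left le_rfl).indicator hAG)
    (fun ω => Set.indicator_nonneg (fun _ _ => (Real.exp_pos _).le) ω)
    (fun ω => (Set.indicator_le_self' (fun _ _ => (Real.exp_pos _).le) ω).trans
      (Real.exp_le_exp.2 (b.pathExpo_le t hξ ω)))
    ha (fun ω => abs_dotProduct_le_one (b.arms_norm_le t ht ω _ (hArm ω)) hξ) hp
    (fun ω => (mu_pos _).le) (fun ω => (mu_lt_one _).le) (b.r_measurable (t + 1))
    (b.r_binary t ht) hcond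
  have hnext : ∀ ω, A.indicator (fun ω => Real.exp (b.pathExpo t ξ ω)) ω
      * Real.exp ((b.x t ω).ofLp ⬝ᵥ ξ * (b.r (t + 1) ω - mu (inner ℝ (b.x t ω) b.θstar))
          - mu (inner ℝ (b.x t ω) b.θstar) * (1 - mu (inner ℝ (b.x t ω) b.θstar))
            * ((b.x t ω).ofLp ⬝ᵥ ξ) ^ 2)
      = A.indicator (fun ω => Real.exp (b.pathExpo (t + 1) ξ ω)) ω := by
    intro ω
    by_cases h : ω ∈ A
    · rw [Set.indicator_of_mem h, Set.indicator_of_mem h, ← Real.exp_add, ← muDot_eq]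
      congr 1
      rw [Bandit.pathExpo, Bandit.pathExpo, expo, expo, Finset.sum_Ico_succ_top ht]
      ring
    · rw [Set.indicator_of_notMem h, Set.indicator_of_notMem h, zero_mul]
  simp only [hnext] at hstep
  have hA' : MeasurableSet A := hG A hAG
  rw [integral_indicator hA', integral_indicator hA'] at hstep
  have hint : ∀ n, IntegrableOn (fun ω => Real.exp (b.pathExpo n ξ ω)) A P := fun n =>
    (Integrable.of_bound ((hE n).mono (b.past_le n) le_rfl).aestronglyMeasurable (Real.exp n)
      (Filter.Eventually.of_forall fun ω => by
        rw [Real.norm_eq_abs, abs_of_pos (Real.exp_pos _)]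
        exact Real.exp_le_exp.2 (b.pathExpo_le n hξ ω))).integrableOn
  have hnn : ∀ n, 0 ≤ᵐ[P.restrict A] fun ω => Real.exp (b.pathExpo n ξ ω) := fun n =>
    Filter.Eventually.of_forall fun ω => (Real.exp_pos _).le
  rw [← ofReal_integral_eq_lintegral_ofReal (hint (t + 1)) (hnn _),
    ← ofReal_integral_eq_lintegral_ofReal (hint t) (hnn _)]
  exact ENNReal.ofReal_le_ofReal hstep

lemma Bandit.setLIntegral_mixture_step (b : Bandit d Ω P) [IsProbabilityMeasure P] (lam : ℝ)
    {t : ℕ} (ht : 1 ≤ t) {A : Set Ω} (hA : MeasurableSet[past b.F0 b.x b.r t] A) :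
    ∫⁻ ω in A, mixture lam (fun s => b.x s ω) (fun s => b.r s ω) b.θstar (t + 1) ∂P
      ≤ ∫⁻ ω in A, mixture lam (fun s => b.x s ω) (fun s => b.r s ω) b.θstar t ∂P := by
  have hswap : ∀ n, ∫⁻ ω in A, mixture lam (fun s => b.x s ω) (fun s => b.r s ω) b.θstar n ∂P
      = ∫⁻ ξ, gaussKer (lam • 1 : Matrix (Fin d) (Fin d) ℝ) 1 ξ
        * ∫⁻ ω in A, ENNReal.ofReal (Real.exp (b.pathExpo n ξ ω)) ∂P := by
    intro n
    have hm := measurable_mixture_integrand (x := b.x) (r := b.r) lam b.θstar (t := n)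
      (fun s _ => b.x_measurable s) (fun s _ => b.r_measurable (s + 1))
    simp only [mixture]
    rw [lintegral_lintegral_swap (f := fun ω ξ => gaussKer (lam • 1 : Matrix (Fin d) (Fin d) ℝ) 1 ξ
      * ENNReal.ofReal (Real.exp (expo (fun s => b.x s ω) (fun s => b.r s ω) b.θstar n ξ)))
      (hm.comp measurable_swap).aemeasurable]
    refine lintegral_congr fun ξ => ?_
    rw [lintegral_const_mul]
    · rfl
    · exact ENNReal.measurable_ofReal.comp (Real.measurable_exp.comp
        ((measurable_expo (x := b.x) (r := b.r) b.θstar (t := n) (fun s _ => b.x_measurable s)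
          (fun s _ => b.r_measurable (s + 1))).comp (measurable_const.prodMk measurable_id)))
  rw [hswap, hswap]
  refine lintegral_mono fun ξ => ?_
  by_cases h : ξ ⬝ᵥ ξ ≤ 1
  · exact mul_le_mul_right (b.setLIntegral_exp_step ht h hA) _
  · rw [gaussKer, Set.indicator_of_notMem (by exact h), zero_mul, zero_mul]

/-- With probability at least `1 - δ`, the confidence sets of all rounds up to `T` contain the
true parameter. -/
theorem Bandit.exists_confidence_event (b : Bandit d Ω P) [IsProbabilityMeasure P] (hd : 1 ≤ d)
    {lam δ : ℝ} (hlam : 0 < lam) (hδ : 0 < δ) {θhat : ℕ → Ω → Vec d}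
    (hmax : ∀ t ≥ 1, ∀ ω,
      IsMaxOn (logLik lam (fun s => b.x s ω) (fun s => b.r s ω) t) Set.univ (θhat t ω))
    {T : ℕ} (hT : 1 ≤ T) :
    ∃ A : Set Ω, MeasurableSet A ∧ ENNReal.ofReal (1 - δ) ≤ P A ∧ ∀ ω ∈ A,
      ∀ t ∈ Finset.Icc 1 T,
        crit lam (fun s => b.x s ω) t (θhat t ω) b.θstar ≤ gam d lam b.S δ t := by
  set Z := ∫⁻ ξ, gaussKer (lam • 1 : Matrix (Fin d) (Fin d) ℝ) 1 ξ with hZ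
  set N : ℕ → Ω → ℝ≥0∞ := fun t ω =>
    mixture lam (fun s => b.x s ω) (fun s => b.r s ω) b.θstar t with hN
  have hNm : ∀ t, Measurable[past b.F0 b.x b.r t] (N t) := fun t =>
    @measurable_mixture d Ω (past b.F0 b.x b.r t) b.x b.r lam b.θstar t
      (fun s hs => measurable_arm_past b.F0 b.x b.r hs)
      (fun s hs => measurable_reward_past b.F0 b.x b.r hs)
  set A : Set Ω := {ω | ∀ t ∈ Finset.Icc 1 T, N t ω < Z / ENNReal.ofReal δ} with hA
  have hAm : MeasurableSet A := by
    have e : A = ⋂ t ∈ Finset.Icc 1 T, {ω | N t ω < Z / ENNReal.ofReal δ} := by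
      ext; simp [hA]
    rw [e]
    refine Finset.measurableSet_biInter _ fun t _ => ?_
    exact measurableSet_lt ((hNm t).mono (b.past_le t) le_rfl) measurable_const
  have hZ0 : Z ≠ 0 := lintegral_gaussKer_ne_zero _ one_pos
  have hZt : Z ≠ ∞ := lintegral_gaussKer_ne_top (Matrix.PosSemidef.one.smul hlam.le) 1
  have hville := ville (P := P) (past_mono b.F0 b.x b.r) b.past_le (N := N)
    (fun t _ => hNm t) (fun t ht A hA => b.setLIntegral_mixture_step lam ht hA)
    (Z / ENNReal.ofReal δ) hT
  have hone : ∫⁻ ω, N 1 ω ∂P = Z := by simp [hN, mixture_one, hZ]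
  rw [hone, ← hA, ENNReal.div_eq_inv_mul, mul_right_comm] at hville
  have hle : P Aᶜ ≤ ENNReal.ofReal δ := by
    have hδ0 : ENNReal.ofReal δ ≠ 0 := by simpa using hδ
    have h1 : (ENNReal.ofReal δ)⁻¹ * P Aᶜ ≤ 1 := by
      refine (ENNReal.mul_le_mul_iff_left hZ0 hZt).1 ?_
      rwa [one_mul]
    rwa [← ENNReal.div_eq_inv_mul, ENNReal.div_le_iff hδ0 ENNReal.ofReal_ne_top, one_mul] at h1
  refine ⟨A, hAm, ?_, fun ω hω t ht => ?_⟩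
  · rw [ENNReal.ofReal_sub _ hδ.le, ENNReal.ofReal_one]
    refine tsub_le_iff_right.2 ?_
    calc (1 : ℝ≥0∞) = P A + P Aᶜ := by rw [measure_add_measure_compl hAm, measure_univ]
      _ ≤ _ := add_le_add le_rfl hle
  · have ht1 := (Finset.mem_Icc.1 ht).1
    exact crit_le_of_mixture_lt hd hlam hδ
      (fun s hs => b.arms_norm_le s hs ω _ (b.x_mem s hs ω)) (b.norm_le_S b.θstar_mem)
      (hmax t ht1 ω) (hω t ht)

/-- The regret bound with explicit constants. -/
theorem Bandit.exists_regret_event (b : Bandit d Ω P) [IsProbabilityMeasure P] (hd : 1 ≤ d)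
    {lam δ : ℝ} (hlam : 0 < lam) (hδ : 0 < δ) (hδ1 : δ ≤ 1) {θhat θ2 : ℕ → Ω → Vec d}
    (alg : b.IsSecondAlgorithm lam δ θhat θ2) {T : ℕ} (hT : 1 ≤ T) :
    ∃ A : Set Ω, MeasurableSet A ∧ ENNReal.ofReal (1 - δ) ≤ P A ∧ ∀ ω ∈ A,
      b.regret T ω ≤ C2 d lam b.S T * gam d lam b.S δ T * Real.sqrt T
        + C3 d lam b.kappa b.S T * gam d lam b.S δ T ^ 2 * b.kappa := by
  obtain ⟨A, hAm, hP, h⟩ := b.exists_confidence_event hd hlam hδ alg.isMax_θhat hT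
  exact ⟨A, hAm, hP, fun ω hω => b.regret_le_of_crit_le hd hlam hδ hδ1 alg T (h ω hω)⟩

end Trajectory

/-! ### The regularization `λ = d log T` -/

section Tuning

variable {d T : ℕ}

lemma half_le_log (hT : 2 ≤ T) : 1 / 2 ≤ Real.log T := by
  have h1 := Real.log_two_gt_d9
  have h2 := Real.log_le_log (by norm_num : (0 : ℝ) < 2) (by exact_mod_cast hT : (2 : ℝ) ≤ T)
  linarith

lemma log_one_add_le (hT : 2 ≤ T) {y : ℝ} (h0 : 0 ≤ y) (hy : y ≤ T) :
    Real.log (1 + y) ≤ 2 * Real.log T := by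
  have hT' : (2 : ℝ) ≤ T := by exact_mod_cast hT
  have h : Real.log (1 + y) ≤ Real.log ((T : ℝ) ^ 2) :=
    Real.log_le_log (by linarith) (by nlinarith)
  rwa [Real.log_pow, Nat.cast_ofNat] at h

lemma half_le_lam (hd : 1 ≤ d) (hT : 2 ≤ T) : 1 / 2 ≤ d * Real.log T := by
  have h1 : (1 : ℝ) ≤ d := by exact_mod_cast hd
  nlinarith [half_le_log hT]

lemma mul_natCast_div_le {K q : ℝ} (hd : 1 ≤ d) (hK : 0 ≤ K) (hq : K ≤ q) :
    K * T / (d * q) ≤ T := by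
  have h1 : (1 : ℝ) ≤ d := by exact_mod_cast hd
  rcases hK.eq_or_lt with h | h
  · rw [← h]; simp
  · rw [div_le_iff₀ (mul_pos (by linarith) (by linarith)), mul_comm]
    refine mul_le_mul_of_nonneg_left ?_ (Nat.cast_nonneg T)
    nlinarith

lemma gam_le_of_log {S δ : ℝ} (hd : 1 ≤ d) (hT : 2 ≤ T) (hδ : 0 < δ) (hδ1 : δ ≤ 1) :
    gam d (d * Real.log T) S δ T
      ≤ (S + 5 + 4 * Real.log (1 / δ)) * Real.sqrt (d * Real.log T) := by
  have hℓ := half_le_log hT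
  have hlam := half_le_lam hd hT
  have hd1 : (1 : ℝ) ≤ d := by exact_mod_cast hd
  set lam := d * Real.log T with hlamdef
  have hlam0 : 0 < lam := by linarith
  have hs : 0 < Real.sqrt lam := Real.sqrt_pos.2 hlam0
  have hΛ : 0 ≤ Real.log (1 / δ) := Real.log_nonneg (by rw [le_div_iff₀ hδ]; linarith)
  have hL : (0 : ℝ) ≤ L := by norm_num [L]
  have h0 : (0 : ℝ) ≤ L * T / (d * lam) := by positivity
  have hB := log_one_add_le hT h0 (mul_natCast_div_le hd hL (by norm_num [L]; linarith))
  have hlog : Real.log (2 ^ d / δ * (1 + L * T / (d * lam)) ^ ((d : ℝ) / 2))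
      ≤ (2 + 2 * Real.log (1 / δ)) * lam := by
    rw [Real.log_mul (by positivity) (by positivity), Real.log_rpow (by positivity),
      div_eq_mul_one_div (2 ^ d), Real.log_mul (by positivity) (by positivity), Real.log_pow]
    have h2 : Real.log 2 ≤ Real.log T :=
      Real.log_le_log (by norm_num) (by exact_mod_cast hT)
    nlinarith [mul_le_mul_of_nonneg_left h2 (show (0 : ℝ) ≤ d by positivity),
      mul_le_mul_of_nonneg_left hB (show (0 : ℝ) ≤ (d : ℝ) / 2 by positivity),
      mul_le_mul_of_nonneg_left hlam hΛ]
  have h3 := mul_le_mul_of_nonneg_left hlog (show 0 ≤ 2 / Real.sqrt lam by positivity)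
  have e : 2 / Real.sqrt lam * ((2 + 2 * Real.log (1 / δ)) * lam)
      = (4 + 4 * Real.log (1 / δ)) * Real.sqrt lam := by
    nth_rewrite 2 [← Real.mul_self_sqrt hlam0.le]
    field_simp; ring
  rw [e] at h3
  rw [gam]
  nlinarith

lemma C2_le_of_log {S : ℝ} (hd : 1 ≤ d) (hT : 2 ≤ T) (hS : 0 ≤ S) :
    C2 d (d * Real.log T) S T ≤ (4 + 8 * S) * Real.sqrt (d * Real.log T) := by
  have hlam := half_le_lam hd hT
  have hℓ := half_le_log hT
  have hd1 : (1 : ℝ) ≤ d := by exact_mod_cast hd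
  set lam := d * Real.log T with hlamdef
  have hL : (0 : ℝ) ≤ L := by norm_num [L]
  have hB := log_one_add_le hT (show (0 : ℝ) ≤ L * T / (d * lam) by positivity)
    (mul_natCast_div_le hd hL (by norm_num [L]; linarith))
  have hmax : max 1 (L / lam) = 1 := by
    refine max_eq_left ((div_le_one (by linarith)).2 ?_)
    norm_num [L]; linarith
  rw [C2, hmax]
  refine mul_le_mul_of_nonneg_left (Real.sqrt_le_sqrt ?_) (by positivity)
  have := mul_le_mul_of_nonneg_left hB (show 0 ≤ 2 * d * L * 1 by positivity)
  refine this.trans (le_of_eq ?_)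
  rw [hlamdef, L]; ring

lemma C3_le_of_log {S κ : ℝ} (hd : 1 ≤ d) (hT : 2 ≤ T) (hS : 0 ≤ S) (hκ : 4 ≤ κ) :
    C3 d (d * Real.log T) κ S T
      ≤ (4 + 8 * S) * (2 + 2 * Real.sqrt (1 + 2 * S)) * (d * Real.log T) := by
  have hlam := half_le_lam hd hT
  have hℓ := half_le_log hT
  have hd1 : (1 : ℝ) ≤ d := by exact_mod_cast hd
  set lam := d * Real.log T with hlamdef
  have hlam0 : 0 < lam := by linarith
  have hκl : 1 ≤ κ * lam := by nlinarith
  have hB := log_one_add_le hT (y := T / (κ * d * lam)) (by positivity) (by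
    have := mul_natCast_div_le (T := T) hd zero_le_one hκl
    rwa [one_mul, show (d : ℝ) * (κ * lam) = κ * d * lam by ring] at this)
  have hmax : max 1 (1 / (κ * lam)) = 1 :=
    max_eq_left ((div_le_one (by linarith)).2 hκl)
  rw [C3, hmax]
  have hc : 0 ≤ (8 + 16 * S) * (2 + 2 * Real.sqrt (1 + 2 * S)) := by positivity
  have hM : M * d * 1 * Real.log (1 + T / (κ * d * lam)) ≤ lam / 2 := by
    have := mul_le_mul_of_nonneg_left hB (show 0 ≤ M * d * 1 by norm_num [M])
    refine this.trans (le_of_eq ?_)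
    rw [hlamdef, M]; ring
  have := mul_le_mul_of_nonneg_right hM hc
  linarith

/-- The constant of the regret bound for the regularization `λ = d log T`. -/
def tunedConst (S δ : ℝ) : ℝ :=
  (4 + 8 * S) * (S + 5 + 4 * Real.log (1 / δ))
    + (4 + 8 * S) * (2 + 2 * Real.sqrt (1 + 2 * S)) * (S + 5 + 4 * Real.log (1 / δ)) ^ 2

lemma explicit_bound_le_tuned {S δ κ : ℝ} (hd : 1 ≤ d) (hT : 2 ≤ T) (hδ : 0 < δ) (hδ1 : δ ≤ 1)
    (hS : 0 ≤ S) (hκ : 4 ≤ κ) :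
    C2 d (d * Real.log T) S T * gam d (d * Real.log T) S δ T * Real.sqrt T
        + C3 d (d * Real.log T) κ S T * gam d (d * Real.log T) S δ T ^ 2 * κ
      ≤ tunedConst S δ
        * (d * Real.sqrt T * Real.log T + κ * (d : ℝ) ^ 2 * Real.log T ^ 2) := by
  have h1 := gam_le_of_log (S := S) hd hT hδ hδ1
  have h2 := C2_le_of_log hd hT hS
  have h3 := C3_le_of_log hd hT hS hκ
  have hℓ := half_le_log hT
  have hlam := half_le_lam hd hT
  have hΛ : 0 ≤ Real.log (1 / δ) := Real.log_nonneg (by rw [le_div_iff₀ hδ]; linarith)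
  have h0 : 0 ≤ gam d (d * Real.log T) S δ T := gam_nonneg (by linarith) hS hδ hδ1 T
  set lam := d * Real.log T with hlamdef
  have hlam0 : 0 < lam := by linarith
  set a := S + 5 + 4 * Real.log (1 / δ) with ha
  have ha0 : 0 ≤ a := by positivity
  set c := (4 + 8 * S) * (2 + 2 * Real.sqrt (1 + 2 * S)) with hc
  have hc0 : 0 ≤ c := by positivity
  have h4 : C2 d lam S T * gam d lam S δ T * Real.sqrt T
      ≤ (4 + 8 * S) * a * (lam * Real.sqrt T) := by
    calc C2 d lam S T * gam d lam S δ T * Real.sqrt T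
        ≤ ((4 + 8 * S) * Real.sqrt lam) * (a * Real.sqrt lam) * Real.sqrt T := by gcongr
      _ = (4 + 8 * S) * a * ((Real.sqrt lam * Real.sqrt lam) * Real.sqrt T) := by ring
      _ = _ := by rw [Real.mul_self_sqrt hlam0.le]
  have h5 : C3 d lam κ S T * gam d lam S δ T ^ 2 * κ ≤ c * a ^ 2 * (κ * lam ^ 2) := by
    calc C3 d lam κ S T * gam d lam S δ T ^ 2 * κ
        ≤ (c * lam) * (a * Real.sqrt lam) ^ 2 * κ := by gcongr
      _ = c * a ^ 2 * (κ * (lam * (Real.sqrt lam) ^ 2)) := by ring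
      _ = _ := by rw [Real.sq_sqrt hlam0.le]; ring
  have e1 : d * Real.sqrt T * Real.log T = lam * Real.sqrt T := by rw [hlamdef]; ring
  have e2 : κ * (d : ℝ) ^ 2 * Real.log T ^ 2 = κ * lam ^ 2 := by rw [hlamdef]; ring
  rw [e1, e2, tunedConst, ← ha, ← hc]
  have h6 : 0 ≤ (4 + 8 * S) * a * (κ * lam ^ 2) := by positivity
  have h7 : 0 ≤ c * a ^ 2 * (lam * Real.sqrt T) := by positivity
  linarith

end Tuning

end LogisticBandit

end

theorem theorem3 :
    (∀ (d : ℕ) (_ : 1 ≤ d) (Ω : Type*) [MeasurableSpace Ω] (P : Measure Ω)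
        [IsProbabilityMeasure P] (b : LogisticBandit.Bandit d Ω P)
        (lam δ : ℝ) (_ : 0 < lam) (_ : 0 < δ) (_ : δ ≤ 1)
        (θhat θ2 : ℕ → Ω → LogisticBandit.Vec d)
        (_ : b.IsSecondAlgorithm lam δ θhat θ2) (T : ℕ) (_ : 1 ≤ T),
      ∃ A : Set Ω, MeasurableSet A ∧ ENNReal.ofReal (1 - δ) ≤ P A ∧ ∀ ω ∈ A,
        b.regret T ω ≤
          LogisticBandit.C2 d lam b.S T * LogisticBandit.gam d lam b.S δ T * Real.sqrt T
          + LogisticBandit.C3 d lam b.kappa b.S T * LogisticBandit.gam d lam b.S δ T ^ 2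
              * b.kappa) ∧
    (∃ C : ℝ → ℝ → ℝ,
      ∀ (d : ℕ) (_ : 1 ≤ d) (Ω : Type*) [MeasurableSpace Ω] (P : Measure Ω)
        [IsProbabilityMeasure P] (b : LogisticBandit.Bandit d Ω P)
        (δ : ℝ) (_ : 0 < δ) (_ : δ ≤ 1) (T : ℕ) (_ : 2 ≤ T)
        (θhat θ2 : ℕ → Ω → LogisticBandit.Vec d)
        (_ : b.IsSecondAlgorithm (d * Real.log T) δ θhat θ2),
      ∃ A : Set Ω, MeasurableSet A ∧ ENNReal.ofReal (1 - δ) ≤ P A ∧ ∀ ω ∈ A,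
        b.regret T ω ≤
          C b.S δ * (d * Real.sqrt T * Real.log T
            + b.kappa * (d : ℝ) ^ 2 * Real.log T ^ 2)) := by
  refine ⟨fun d hd Ω _ P _ b lam δ hlam hδ hδ1 θhat θ2 alg T hT =>
    b.exists_regret_event hd hlam hδ hδ1 alg hT, LogisticBandit.tunedConst,
    fun d hd Ω _ P _ b δ hδ hδ1 T hT θhat θ2 alg => ?_⟩
  have hlam : 0 < d * Real.log T := by linarith [LogisticBandit.half_le_lam hd hT]
  obtain ⟨A, hA, hP, h⟩ := b.exists_regret_event hd hlam hδ hδ1 alg (by omega : 1 ≤ T)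
  exact ⟨A, hA, hP, fun ω hω => (h ω hω).trans
    (LogisticBandit.explicit_bound_le_tuned hd hT hδ hδ1 b.S_nonneg (b.four_le_kappa ω))⟩
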